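/- **Theorem 3 (estimation error for the Borda count algorithm).** Let $m\ge 2$ and $[d]=\{1,\dots,d\}$. For an order-$m$ tensor $T\in\mathbb R^{d\times\cdots\times d}$ and a permutation $\pi$ of $[d]$ write $(T\circ\pi)(i_1,\dots,i_m)=T(\pi(i_1),\dots,\pi(i_m))$, $\|T\|_F^2=\sum_\omega T(\omega)^2$ and $\mathrm{MSE}(T_1,T_2)=d^{-m}\|T_1-T_2\|_F^2$. *Model.* One observes $\mathcal Y=\Theta\circ\pi+\mathcal E$, where $\pi$ is an unknown permutation of $[d]$, $\Theta(i_1,\dots,i_m)=f(i_1/d,\dots,i_m/d)$ for an unknown $f:[0,1]^m\to\mathbb R$, and the $d^m$ entries of $\mathcal E$ are independent (not necessarily identically distributed) zero-mean sub-Gaussian random variables with variance proxy $\sigma^2$, i.e. $\mathbb E\,e^{t\mathcal E(\omega)}\le e^{\sigma^2t^2/2}$ for all $t\in\mathbb R$; here $\sigma>0$. *Function classes.* Let $\alpha,\beta\ge 0$ and $L>0$. $f\in\mathcal H(\alpha,L)$ means: for every $x_0\in[0,1]^m$ there is a polynomial $P_{x_0}$ of degree at most $\lfloor\alpha\rfloor$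 with $|f(x)-P_{x_0}(x-x_0)|\le L\|x-x_0\|_\infty^\alpha$ for all $x\in[0,1]^m$ (with $0^0=1$). $f\in\mathcal M(\beta)$ (weak $\beta$-monotonicity, in dimension $d$, with constants $c_0>0$ and $D$) means: there is $\delta$ with $0\le\delta\le D\,d^{-(m-1)/2}$ and $$c_0\Big(\frac{i-j}{d}\Big)^{1/\beta}\le g(i)-g(j)+\delta\quad\text{for all } j<i \text{ in } [d],\qquad g(i)=d^{-(m-1)}\sum_{i_2,\dots,i_m\in[d]}f\Big(\frac id,\frac{i_2}d,\dots,\frac{i_m}d\Big),$$ where the left-hand side is read as $0$ if $\beta=0$. *Estimator.* Let $1\le k\le d$ and $\ell\ge 0$ be integers. Let $z(i)=\lceil ki/d\rceil$, and let $\mathscr B(k,\ell)$ be the set of tensors which, on each block $z^{-1}(j_1)\times\cdots\times z^{-1}(j_m)$, agree with a polynomial of degree at most $\ell$ in the multi-index (depending on the block). Let $\tau(i)=d^{-(m-1)}\sum_{i_2,\dots,i_m}\mathcal Y(i,i_2,\dots,i_m)$. The Borda count estimator consists of a permutation $\hat\pi$ with $\tau(\hat\pi^{-1}(1))\le\cdots\le\tau(\hat\pi^{-1}(d))$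 (ties broken in any way) and $\hat\Theta\in\arg\min_{B\in\mathscr B(k,\ell)}\|\mathcal Y\circ\hat\pi^{-1}-B\|_F$. *Claim.* Let $M$ be a bound on the oscillation: $|f(x)-f(y)|\le M$ for all $x,y\in[0,1]^m$ (each $f\in\mathcal H(\alpha,L)$ is bounded, so it has such an $M$). Let $p>0$ and $c_1>0$. There is a constant $C>0$ that depends only on $(m,\alpha,\beta,L,\sigma,c_0,D,M,p,c_1)$, and not on $d,k,\ell,\pi$, the noise distribution, or $f$ otherwise, such that for every $d\ge 1$ and every $f\in\mathcal H(\alpha,L)\cap\mathcal M(\beta)$ as above the following holds. 1. For all integers $1\le k\le d$ and $\ell\ge 0$, with probability at least $1-d^{-p}$, $$\mathrm{MSE}(\hat\Theta\circ\hat\pi,\Theta\circ\pi)\le C\left[\frac{L^2}{k^{2\min(\alpha,\ell+1)}}+\sigma^2\frac{k^m(\ell+m)^\ell}{d^m}+\Big(\sigma^2\frac{\log d}{d^{m-1}}\Big)^{\beta\min(\alpha,1)}\right].$$ 2. Put $c(\alpha,\beta,m)=\dfrac{m(m-1)\beta\min(\alpha,1)}{\max\big(0,\,2(m-(m-1)\beta\min(\alpha,1))\big)}\in[0,\infty]$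 (equal to $\infty$ if the denominator is $0$), $\ell^*=\min(\lfloor\alpha\rfloor,\lfloor c(\alpha,\beta,m)\rfloor)$ and $k^*=\min\big(d,\lceil c_1d^{m/(m+2\min(\alpha,\ell^*+1))}\rceil\big)$. Then the estimator with $(k,\ell)=(k^*,\ell^*)$ satisfies, with probability at least $1-d^{-p}$, $$\mathrm{MSE}(\hat\Theta\circ\hat\pi,\Theta\circ\pi)\le\begin{cases}C\,d^{-2m\alpha/(m+2\alpha)}&\text{if }\alpha<c(\alpha,\beta,m),\\[2pt] C\,\big(\log d/d^{m-1}\big)^{\beta\min(\alpha,1)}&\text{if }\alpha\ge c(\alpha,\beta,m).\end{cases}$$ -/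

import Mathlib

open MeasureTheory ProbabilityTheory
open scoped ENNReal NNReal

noncomputable section

namespace Borda

/-- Real tensors of order `m` and dimension `d` (in every mode). The index `i : Fin d` stands for
the integer `i + 1` of `{1, …, d}`. -/
abbrev Tensor (m d : ℕ) : Type := (Fin m → Fin d) → ℝ

variable {m d : ℕ}

/-- Squared Frobenius norm. -/
def frobSq (T : Tensor m d) : ℝ := ∑ i, T i ^ 2

/-- Mean squared error `d⁻ᵐ ‖T₁ - T₂‖_F²`. -/
def mse (T₁ T₂ : Tensor m d) : ℝ := frobSq (T₁ - T₂) / (d : ℝ) ^ m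

/-- The permuted tensor `(T ∘ π)(i₁, …, iₘ) = T(π(i₁), …, π(iₘ))`. -/
def permute (T : Tensor m d) (π : Equiv.Perm (Fin d)) : Tensor m d :=
  fun i => T (fun a => π (i a))

/-- The signal tensor `Θ(i₁, …, iₘ) = f(i₁ / d, …, iₘ / d)`, for `i₁, …, iₘ` in `{1, …, d}`. -/
def signal (d : ℕ) (f : (Fin m → ℝ) → ℝ) : Tensor m d :=
  fun i => f (fun a => (((i a : ℕ) : ℝ) + 1) / (d : ℝ))

/-- The score of index `i`: the average of the entries of `T` over all multi-indices whose
first coordinate is `i`. -/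
def score [NeZero m] (T : Tensor m d) (i : Fin d) : ℝ :=
  (∑ ω : Fin m → Fin d with ω 0 = i, T ω) / (d : ℝ) ^ (m - 1)

/-- The `α`-Hölder class with constant `L` on the unit cube (`Fin m → ℝ` carries the sup norm,
and `0 ^ 0 = 1`): around every point `x₀` the function is approximated by a polynomial in `x - x₀`
of degree at most `⌊α⌋`. -/
def IsHolderSmooth (α L : ℝ) (f : (Fin m → ℝ) → ℝ) : Prop :=
  ∀ x₀ ∈ Set.Icc (0 : Fin m → ℝ) 1, ∃ P : MvPolynomial (Fin m) ℝ,
    P.totalDegree ≤ ⌊α⌋₊ ∧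
    ∀ x ∈ Set.Icc (0 : Fin m → ℝ) 1, |f x - MvPolynomial.eval (x - x₀) P| ≤ L * ‖x - x₀‖ ^ α

/-- `t ^ (1 / β)` for `0 < t < 1`, with the limiting value `0` for `β = 0`. -/
def rootPow (β t : ℝ) : ℝ := if β = 0 then 0 else t ^ (1 / β)

/-- Weak `β`-monotonicity at dimension `d`, with explicit constants: for some tolerance
`0 ≤ δ ≤ D d^{-(m-1)/2}`, the score function `g` of `f` satisfies
`c₀ ((i - j) / d)^{1/β} ≤ g(i) - g(j) + δ` for all `j < i`. -/
def IsWeaklyMonotone [NeZero m] (d : ℕ) (β c₀ D : ℝ) (f : (Fin m → ℝ) → ℝ) : Prop :=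
  ∃ δ : ℝ, 0 ≤ δ ∧ δ ≤ D * (d : ℝ) ^ (-((m : ℝ) - 1) / 2) ∧
    ∀ i j : Fin d, j < i →
      c₀ * rootPow β ((((i : ℕ) : ℝ) - ((j : ℕ) : ℝ)) / (d : ℝ)) ≤
        score (signal d f) i - score (signal d f) j + δ

/-- The canonical clustering `z(i) = ⌈k i / d⌉`, with values in `{1, …, k}`. -/
def cluster (d k : ℕ) (i : Fin d) : ℕ := ⌈(k : ℝ) * (((i : ℕ) : ℝ) + 1) / (d : ℝ)⌉₊

/-- The block-`k` degree-`ℓ` tensors: on every block (determined by the labels of the `m`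
coordinates) the entries are given by a polynomial of degree at most `ℓ` in the multi-index. -/
def blockPoly (m d k ℓ : ℕ) : Set (Tensor m d) :=
  {B | ∃ P : (Fin m → ℕ) → MvPolynomial (Fin m) ℝ,
    (∀ b, (P b).totalDegree ≤ ℓ) ∧
    ∀ ω : Fin m → Fin d,
      B ω = MvPolynomial.eval (fun a => ((ω a : ℕ) : ℝ) + 1) (P (fun a => cluster d k (ω a)))}

/-- `(πhat, Θhat)` is a Borda count estimate for the observed tensor `Y`: the scores of `Y` are
increasing in the order given by `πhat` (ties broken arbitrarily), and `Θhat` is a least-squares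
fit to the sorted tensor `Y ∘ πhat⁻¹` among the block-`k` degree-`ℓ` tensors. -/
def IsBordaEstimate [NeZero m] (k ℓ : ℕ) (Y : Tensor m d)
    (πhat : Equiv.Perm (Fin d)) (Θhat : Tensor m d) : Prop :=
  (∀ i j : Fin d, i ≤ j → score Y (πhat.symm i) ≤ score Y (πhat.symm j)) ∧
  Θhat ∈ blockPoly m d k ℓ ∧
  ∀ B ∈ blockPoly m d k ℓ,
    frobSq (permute Y πhat.symm - Θhat) ≤ frobSq (permute Y πhat.symm - B)

/-- Probability (outer measure, should the event fail to be measurable) that some Borda count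
estimate computed from `Y = Θ ∘ π + ξ` has a mean squared error larger than `r`. -/
def failureProb [NeZero m] {Ω : Type*} [MeasurableSpace Ω] (μ : Measure Ω) (k ℓ : ℕ)
    (Θ : Tensor m d) (π : Equiv.Perm (Fin d)) (ξ : (Fin m → Fin d) → Ω → ℝ) (r : ℝ) : ℝ≥0∞ :=
  μ {ω | ∃ (πhat : Equiv.Perm (Fin d)) (Θhat : Tensor m d),
    IsBordaEstimate k ℓ (permute Θ π + fun i => ξ i ω) πhat Θhat ∧
    r < mse (permute Θhat πhat) (permute Θ π)}

/-- The right-hand side `L² / k^{2 min(α, ℓ+1)} + σ² kᵐ (ℓ+m)^ℓ / dᵐ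
+ (σ² log d / d^{m-1})^{β min(α, 1)}`. -/
def errorBound (m d k ℓ : ℕ) (α β L σ : ℝ) : ℝ :=
  L ^ 2 / (k : ℝ) ^ (2 * min α ((ℓ : ℝ) + 1))
    + σ ^ 2 * ((k : ℝ) ^ m * ((ℓ : ℝ) + (m : ℝ)) ^ ℓ / (d : ℝ) ^ m)
    + (σ ^ 2 * (Real.log d / (d : ℝ) ^ (m - 1))) ^ (β * min α 1)

/-- The threshold `c(α, β, m) = m (m-1) β min(α, 1) / max(0, 2 (m - (m-1) β min(α, 1)))`, which is
`∞` when the denominator vanishes (`ENNReal.ofReal x` is `max(0, x)`). -/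
def threshold (m : ℕ) (α β : ℝ) : ℝ≥0∞ :=
  ENNReal.ofReal ((m : ℝ) * ((m : ℝ) - 1) * β * min α 1) /
    ENNReal.ofReal (2 * ((m : ℝ) - ((m : ℝ) - 1) * β * min α 1))

/-- The degree `ℓ* = min(⌊α⌋, ⌊c(α, β, m)⌋)`. -/
def optDegree (m : ℕ) (α β : ℝ) : ℕ :=
  if threshold m α β = ⊤ then ⌊α⌋₊ else min ⌊α⌋₊ ⌊(threshold m α β).toReal⌋₊

/-- The block number `k* = c₁ d^{m / (m + 2 min(α, ℓ* + 1))}`, rounded up to an integer and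
truncated at `d`. -/
def optBlocks (m d : ℕ) (α β c₁ : ℝ) : ℕ :=
  min d ⌈c₁ * (d : ℝ) ^ ((m : ℝ) / ((m : ℝ) + 2 * min α ((optDegree m α β : ℝ) + 1)))⌉₊

end Borda

end

/-!
The estimate splits into approximation, noise and misordering. Put `ρ = π ∘ πhat⁻¹`, so that the
sorted observation is `Θ ∘ ρ` plus permuted noise, and let `B` be a block polynomial tensor close
to `Θ`. The basic inequality of least squares (`frobSq_sub_le_of_least_squares`) bounds the error
by `‖Θ ∘ ρ - B‖²` plus the squared norm of the noise projected on the space of block polynomials.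

* Approximation (`exists_blockPoly_approx`): on each block the local polynomial of `f`, truncated at
  degree `ℓ`, has error of order `k ^ (-min α (ℓ + 1))`. The truncated terms are controlled by the
  oscillation of `f`, through one-dimensional coefficient bounds on segments inside the cube.
* Misordering (`mse_le_of_noise_bounds`): if `ρ` moves an index far, it has a large inversion by the
  pigeonhole principle, and weak monotonicity makes the corresponding scores differ by more than
  the noise of the scores allows. Hence `|ρ(i) - i| / d` is of the order of the `β`-th power of
  `√(σ² log d / d^{m-1})`, and `f` is `min α 1`-Hölder.
* Noise (`measure_exists_perm_gt_le`): the squared norm of the projection on a space of dimension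
  `N` has exponential moment `exp (N / 2)` by Gaussian linearisation. The noise is reordered by a data
  dependent permutation, so a union bound over all `d!` permutations is taken; it costs `d log d`,
  that is `σ² log d / d^{m-1}` in mean squared error.

The last cost has to be dominated by `(σ² log d / d^{m-1}) ^ κ` with `κ = β min(α, 1)`. For `κ ≤ 1`
this is clear. For `κ > 1` smoothness and monotonicity are incompatible at small scales, which
bounds `d` (`exists_dim_bound`).

For the tuned parameters, the approximation error and the variance are both of order
`d ^ (-2 m a / (m + 2 a))` with `a = min α (ℓ* + 1)`, and the threshold `c(α, β, m)` is the value of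
`a` at which this exponent equals that of the permutation term.
-/

noncomputable section

namespace Borda

/-! ### Local polynomial approximation of Hölder smooth functions -/

section

/-- The coefficients of a real polynomial of degree at most `n` are bounded by a multiple of its
supremum on `[0, 1]`: they are recovered from `n + 1` values by an inverse Vandermonde matrix. -/
theorem exists_coeff_bound (n : ℕ) : ∃ K : ℝ, 0 ≤ K ∧ ∀ (c : ℕ → ℝ) (A : ℝ),
    (∀ t : ℝ, 0 ≤ t → t ≤ 1 → |∑ j ∈ Finset.range (n + 1), c j * t ^ j| ≤ A) →
    ∀ j ≤ n, |c j| ≤ K * A := by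
  classical
  set v : Fin (n + 1) → ℝ := fun i => (i : ℝ) / (n + 1)
  have hv : Function.Injective v := by
    intro i j h
    have h1 : (i : ℝ) = j := by
      have : (n + 1 : ℝ) ≠ 0 := by positivity
      simpa [v, div_left_inj' this] using h
    exact Fin.ext (by exact_mod_cast h1)
  set V := Matrix.vandermonde v
  have hdet : IsUnit V.det := (Matrix.det_vandermonde_ne_zero_iff.2 hv).isUnit
  refine ⟨∑ i, ∑ j, |V⁻¹ i j|, by positivity, fun c A hA j hj => ?_⟩
  have hA0 : 0 ≤ A := (abs_nonneg _).trans (hA 0 le_rfl zero_le_one)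
  set c' : Fin (n + 1) → ℝ := fun j => c j
  have hval : ∀ i, |V.mulVec c' i| ≤ A := by
    intro i
    have h := hA (v i) (by positivity) (by
      simp only [v]
      rw [div_le_one (by positivity)]
      have := i.2
      exact_mod_cast this.le)
    rw [← Fin.sum_univ_eq_sum_range (fun j => c j * v i ^ j)] at h
    simpa [Matrix.mulVec, dotProduct, V, Matrix.vandermonde_apply, c', mul_comm] using h
  have hinv : c' = V⁻¹.mulVec (V.mulVec c') := by
    rw [Matrix.mulVec_mulVec, Matrix.nonsing_inv_mul _ hdet, Matrix.one_mulVec]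
  let j' : Fin (n + 1) := ⟨j, by omega⟩
  have hc : c j = ∑ i, V⁻¹ j' i * V.mulVec c' i := congrFun hinv j'
  rw [hc]
  calc |∑ i, V⁻¹ j' i * V.mulVec c' i| ≤ ∑ i, |V⁻¹ j' i| * A := by
        refine (Finset.abs_sum_le_sum_abs _ _).trans (Finset.sum_le_sum fun i _ => ?_)
        rw [abs_mul]
        exact mul_le_mul_of_nonneg_left (hval i) (abs_nonneg _)
    _ = (∑ i, |V⁻¹ j' i|) * A := by rw [Finset.sum_mul]
    _ ≤ _ := by
        refine mul_le_mul_of_nonneg_right ?_ hA0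
        exact Finset.single_le_sum (f := fun i => ∑ j, |V⁻¹ i j|) (fun i _ => by positivity)
          (Finset.mem_univ j')

variable {m : ℕ}

theorem eval_smul_of_isHomogeneous {P : MvPolynomial (Fin m) ℝ} {n : ℕ} (hP : P.IsHomogeneous n)
    (t : ℝ) (y : Fin m → ℝ) :
    MvPolynomial.eval (t • y) P = t ^ n * MvPolynomial.eval y P := by
  rw [MvPolynomial.eval_eq, MvPolynomial.eval_eq, Finset.mul_sum]
  refine Finset.sum_congr rfl fun s hs => ?_
  have hd : ∑ i ∈ s.support, s i = n := by
    have := hP (MvPolynomial.mem_support_iff.1 hs)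
    rw [Finsupp.weight_apply, Finsupp.sum] at this
    simpa using this
  simp only [Pi.smul_apply, smul_eq_mul, mul_pow, Finset.prod_mul_distrib,
    Finset.prod_pow_eq_pow_sum, hd]
  ring

theorem sum_homogeneousComponent_of_le {P : MvPolynomial (Fin m) ℝ} {n : ℕ}
    (hP : P.totalDegree ≤ n) :
    ∑ j ∈ Finset.range (n + 1), MvPolynomial.homogeneousComponent j P = P := by
  conv_rhs => rw [← MvPolynomial.sum_homogeneousComponent P]
  symm
  refine Finset.sum_subset (Finset.range_subset_range.2 (by omega)) fun j _ hj => ?_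
  exact MvPolynomial.homogeneousComponent_eq_zero _ _ (by simpa using hj)

/-- The displacement `y` points from `x₀` into the half of the unit cube that leaves room for it:
in each coordinate it goes up when `x₀` is in the lower half, and down when it is in the upper
half. -/
def Inward (x₀ y : Fin m → ℝ) : Prop :=
  ∀ a, (x₀ a ≤ 1 / 2 ∧ 0 ≤ y a) ∨ (1 / 2 ≤ x₀ a ∧ y a ≤ 0)

theorem Inward.smul {x₀ y : Fin m → ℝ} (h : Inward x₀ y) {t : ℝ} (ht : 0 ≤ t) :
    Inward x₀ (t • y) := by
  intro a
  rcases h a with h | h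
  · exact Or.inl ⟨h.1, mul_nonneg ht h.2⟩
  · exact Or.inr ⟨h.1, mul_nonpos_of_nonneg_of_nonpos ht h.2⟩

theorem Inward.add_mem {x₀ y : Fin m → ℝ} (h : Inward x₀ y)
    (hx₀ : x₀ ∈ Set.Icc (0 : Fin m → ℝ) 1) (hy : ‖y‖ ≤ 1 / 2) :
    x₀ + y ∈ Set.Icc (0 : Fin m → ℝ) 1 := by
  have hya : ∀ a, |y a| ≤ 1 / 2 := fun a => (norm_le_pi_norm y a).trans hy
  constructor <;> intro a <;> have h1 := abs_le.1 (hya a) <;> have h2 := hx₀.1 a <;>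
    have h3 := hx₀.2 a <;> simp only [Pi.zero_apply, Pi.one_apply, Pi.add_apply] at * <;>
    rcases h a with h | h <;> linarith

theorem norm_sub_le_one {x y : Fin m → ℝ} (hx : x ∈ Set.Icc (0 : Fin m → ℝ) 1)
    (hy : y ∈ Set.Icc (0 : Fin m → ℝ) 1) : ‖x - y‖ ≤ 1 := by
  refine (pi_norm_le_iff_of_nonneg zero_le_one).2 fun a => ?_
  have h1 := hx.1 a
  have h2 := hx.2 a
  have h3 := hy.1 a
  have h4 := hy.2 a
  simp only [Pi.zero_apply, Pi.one_apply] at *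
  rw [Pi.sub_apply, Real.norm_eq_abs, abs_le]
  constructor <;> linarith

/-- The local polynomials of a Hölder smooth function with bounded oscillation have controlled
homogeneous components in inward directions. Along such a direction the unit cube leaves room for
a segment of length `1 / 2`, on which the polynomial is bounded, so that `exists_coeff_bound`
applies to its restriction to the segment. The constant term of the polynomial is not controlled:
the function itself may be arbitrarily large. -/
theorem exists_homogeneousComponent_bound (α L M : ℝ) (hα : 0 ≤ α) (hL : 0 < L) :
    ∃ K : ℝ, 0 ≤ K ∧ ∀ f : (Fin m → ℝ) → ℝ,
      (∀ x ∈ Set.Icc (0 : Fin m → ℝ) 1, ∀ y ∈ Set.Icc (0 : Fin m → ℝ) 1, |f x - f y| ≤ M) →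
      ∀ x₀ ∈ Set.Icc (0 : Fin m → ℝ) 1, ∀ P : MvPolynomial (Fin m) ℝ, P.totalDegree ≤ ⌊α⌋₊ →
        (∀ x ∈ Set.Icc (0 : Fin m → ℝ) 1,
          |f x - MvPolynomial.eval (x - x₀) P| ≤ L * ‖x - x₀‖ ^ α) →
        ∀ y, Inward x₀ y → ∀ j, 1 ≤ j → j ≤ ⌊α⌋₊ →
          |MvPolynomial.eval y (MvPolynomial.homogeneousComponent j P)| ≤ K * ‖y‖ ^ j := by
  obtain ⟨K, hK0, hK⟩ := exists_coeff_bound ⌊α⌋₊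
  -- the sum over `j` serves as a bound for its terms, the constant for degree `j`
  refine ⟨∑ j ∈ Finset.range (⌊α⌋₊ + 1), 2 ^ j * (K * (L + |M|)), by positivity, ?_⟩
  intro f hM x₀ hx₀ P hdeg hP y hy j hj1 hjn
  have hhom := MvPolynomial.homogeneousComponent_isHomogeneous j P
  rcases eq_or_ne y 0 with rfl | hy0
  · have : MvPolynomial.eval (0 : Fin m → ℝ) (MvPolynomial.homogeneousComponent j P) = 0 := by
      have h := eval_smul_of_isHomogeneous hhom 0 (0 : Fin m → ℝ)
      rwa [zero_smul, zero_pow (by omega), zero_mul] at h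
    rw [this, abs_zero]
    positivity
  have hny : 0 < ‖y‖ := norm_pos_iff.2 hy0
  set y' : Fin m → ℝ := (1 / (2 * ‖y‖)) • y with hy'
  have hyy' : y = (2 * ‖y‖) • y' := by
    rw [hy', smul_smul]
    field_simp
    simp
  have hny' : ‖y'‖ = 1 / 2 := by
    rw [hy', norm_smul, Real.norm_of_nonneg (by positivity)]
    field_simp
  have hin : Inward x₀ y' := hy.smul (by positivity)
  -- the polynomial along the segment, with the value of `f` at `x₀` removed
  set c : ℕ → ℝ := fun i => MvPolynomial.eval y' (MvPolynomial.homogeneousComponent i P) -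
    if i = 0 then f x₀ else 0
  have hbound : ∀ t : ℝ, 0 ≤ t → t ≤ 1 →
      |∑ i ∈ Finset.range (⌊α⌋₊ + 1), c i * t ^ i| ≤ L + |M| := by
    intro t ht0 ht1
    have hsum : ∑ i ∈ Finset.range (⌊α⌋₊ + 1), c i * t ^ i =
        MvPolynomial.eval (t • y') P - f x₀ := by
      conv_rhs => rw [← sum_homogeneousComponent_of_le hdeg]
      rw [map_sum]
      simp only [c, sub_mul, Finset.sum_sub_distrib]
      congr 1
      · refine Finset.sum_congr rfl fun i _ => ?_
        rw [eval_smul_of_isHomogeneous (MvPolynomial.homogeneousComponent_isHomogeneous i P) t y']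
        ring
      · rw [Finset.sum_eq_single 0]
        · simp
        · intro i _ hi
          simp [hi]
        · simp
    have hnt : ‖t • y'‖ ≤ 1 / 2 := by
      rw [norm_smul, Real.norm_of_nonneg ht0, hny']
      linarith
    have hmem := (hin.smul ht0).add_mem hx₀ hnt
    have h1 := hP _ hmem
    rw [add_sub_cancel_left] at h1
    have h2 : ‖t • y'‖ ^ α ≤ 1 :=
      Real.rpow_le_one (norm_nonneg _) (hnt.trans (by norm_num)) hα
    have h3 := (hM _ hmem _ hx₀).trans (le_abs_self M)
    have h4 : L * ‖t • y'‖ ^ α ≤ L := by nlinarith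
    rw [hsum]
    have h5 := abs_le.1 (h1.trans h4)
    have h6 := abs_le.1 h3
    exact abs_le.2 ⟨by linarith, by linarith⟩
  have hcj := hK c _ hbound j hjn
  have hcj' : c j = MvPolynomial.eval y' (MvPolynomial.homogeneousComponent j P) := by
    simp [c, show j ≠ 0 by omega]
  rw [hcj'] at hcj
  rw [hyy', eval_smul_of_isHomogeneous hhom, ← hyy', abs_mul, abs_of_nonneg (by positivity),
    mul_pow]
  have h7 : 2 ^ j * (K * (L + |M|)) ≤
      ∑ j ∈ Finset.range (⌊α⌋₊ + 1), 2 ^ j * (K * (L + |M|)) :=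
    Finset.single_le_sum (f := fun j => (2 : ℝ) ^ j * (K * (L + |M|)))
      (fun i _ => by positivity) (Finset.mem_range.2 (by omega))
  calc 2 ^ j * ‖y‖ ^ j * |MvPolynomial.eval y' (MvPolynomial.homogeneousComponent j P)|
      ≤ 2 ^ j * ‖y‖ ^ j * (K * (L + |M|)) := by gcongr
    _ = 2 ^ j * (K * (L + |M|)) * ‖y‖ ^ j := by ring
    _ ≤ _ := by gcongr

/-- A Hölder smooth function is approximated near every point, in inward directions, by a
polynomial of any degree `ℓ`, with error of order `min α (ℓ + 1)`: for small `ℓ` the local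
polynomial of degree `⌊α⌋` is truncated. -/
theorem exists_local_approx (α L M : ℝ) (hα : 0 ≤ α) (hL : 0 < L) :
    ∃ K : ℝ, 0 ≤ K ∧ ∀ f : (Fin m → ℝ) → ℝ, IsHolderSmooth α L f →
      (∀ x ∈ Set.Icc (0 : Fin m → ℝ) 1, ∀ y ∈ Set.Icc (0 : Fin m → ℝ) 1, |f x - f y| ≤ M) →
      ∀ (ℓ : ℕ), ∀ x₀ ∈ Set.Icc (0 : Fin m → ℝ) 1, ∃ Q : MvPolynomial (Fin m) ℝ,
        Q.totalDegree ≤ ℓ ∧ ∀ x ∈ Set.Icc (0 : Fin m → ℝ) 1, Inward x₀ (x - x₀) →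
          |f x - MvPolynomial.eval (x - x₀) Q| ≤ K * ‖x - x₀‖ ^ min α ((ℓ : ℝ) + 1) := by
  obtain ⟨K, hK0, hK⟩ := exists_homogeneousComponent_bound (m := m) α L M hα hL
  refine ⟨L + ⌊α⌋₊ * K, by positivity, fun f hf hM ℓ x₀ hx₀ => ?_⟩
  obtain ⟨P, hdeg, hP⟩ := hf x₀ hx₀
  rcases le_or_gt ⌊α⌋₊ ℓ with hℓ | hℓ
  · refine ⟨P, hdeg.trans hℓ, fun x hx _ => (hP x hx).trans ?_⟩
    have h1 : α ≤ (ℓ : ℝ) + 1 := by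
      have := Nat.lt_floor_add_one α
      have h2 : (⌊α⌋₊ : ℝ) ≤ ℓ := by exact_mod_cast hℓ
      linarith
    rw [min_eq_left h1]
    have : 0 ≤ (⌊α⌋₊ : ℝ) * K := by positivity
    gcongr
    linarith
  · refine ⟨∑ j ∈ Finset.range (ℓ + 1), MvPolynomial.homogeneousComponent j P, ?_, ?_⟩
    · refine MvPolynomial.totalDegree_finsetSum_le fun j hj => ?_
      exact (MvPolynomial.homogeneousComponent_isHomogeneous j P).totalDegree_le.trans
        (by have := Finset.mem_range.1 hj; omega)
    · intro x hx hin
      have hα' : (ℓ : ℝ) + 1 ≤ α := by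
        have h2 : ((ℓ + 1 : ℕ) : ℝ) ≤ ⌊α⌋₊ := by exact_mod_cast hℓ
        have := Nat.floor_le hα
        push_cast at h2
        linarith
      rw [min_eq_right hα']
      set y := x - x₀ with hy
      have hny : ‖y‖ ≤ 1 := norm_sub_le_one hx hx₀
      have hpow : ‖y‖ ^ ((ℓ : ℝ) + 1) = ‖y‖ ^ (ℓ + 1) := by
        rw [← Real.rpow_natCast]
        push_cast
        rfl
      have h1 : ‖y‖ ^ α ≤ ‖y‖ ^ (ℓ + 1) := by
        rw [← hpow]
        exact Real.rpow_le_rpow_of_exponent_ge' (norm_nonneg _) hny (by positivity) hα'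
      have hsplit : MvPolynomial.eval y P =
          MvPolynomial.eval y (∑ j ∈ Finset.range (ℓ + 1), MvPolynomial.homogeneousComponent j P) +
          ∑ j ∈ Finset.Ico (ℓ + 1) (⌊α⌋₊ + 1),
            MvPolynomial.eval y (MvPolynomial.homogeneousComponent j P) := by
        conv_lhs => rw [← sum_homogeneousComponent_of_le hdeg]
        rw [map_sum, map_sum, Finset.sum_range_add_sum_Ico _ (by omega)]
      have h2 : |∑ j ∈ Finset.Ico (ℓ + 1) (⌊α⌋₊ + 1),
          MvPolynomial.eval y (MvPolynomial.homogeneousComponent j P)| ≤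
          ⌊α⌋₊ * K * ‖y‖ ^ (ℓ + 1) := by
        refine (Finset.abs_sum_le_sum_abs _ _).trans ?_
        have h3 : ∀ j ∈ Finset.Ico (ℓ + 1) (⌊α⌋₊ + 1),
            |MvPolynomial.eval y (MvPolynomial.homogeneousComponent j P)| ≤
              K * ‖y‖ ^ (ℓ + 1) := by
          intro j hj
          rw [Finset.mem_Ico] at hj
          refine (hK f hM x₀ hx₀ P hdeg hP y hin j (by omega) (by omega)).trans ?_
          exact mul_le_mul_of_nonneg_left (pow_le_pow_of_le_one (norm_nonneg _) hny hj.1) hK0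
        refine (Finset.sum_le_card_nsmul _ _ _ h3).trans ?_
        rw [nsmul_eq_mul, mul_assoc]
        refine mul_le_mul_of_nonneg_right ?_ (by positivity)
        rw [Nat.card_Ico]
        exact_mod_cast (by omega : ⌊α⌋₊ + 1 - (ℓ + 1) ≤ ⌊α⌋₊)
      have h4 := (hP x hx).trans (mul_le_mul_of_nonneg_left h1 hL.le)
      rw [← hy, hsplit] at h4
      rw [hpow]
      have h5 := abs_le.1 h4
      have h6 := abs_le.1 h2
      exact abs_le.2 ⟨by linarith, by linarith⟩

/-- A Hölder smooth function with bounded oscillation is `min α 1`-Hölder continuous. This is the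
case `ℓ = 0` of the local approximation, around a corner of the box spanned by the two points. -/
theorem exists_holder_bound (α L M : ℝ) (hα : 0 ≤ α) (hL : 0 < L) :
    ∃ K : ℝ, 0 ≤ K ∧ ∀ f : (Fin m → ℝ) → ℝ, IsHolderSmooth α L f →
      (∀ x ∈ Set.Icc (0 : Fin m → ℝ) 1, ∀ y ∈ Set.Icc (0 : Fin m → ℝ) 1, |f x - f y| ≤ M) →
      ∀ x ∈ Set.Icc (0 : Fin m → ℝ) 1, ∀ y ∈ Set.Icc (0 : Fin m → ℝ) 1,
        |f x - f y| ≤ K * ‖x - y‖ ^ min α 1 := by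
  obtain ⟨K, hK0, hK⟩ := exists_local_approx (m := m) α L M hα hL
  refine ⟨2 * K, by positivity, fun f hf hM x hx y hy => ?_⟩
  -- the corner of the box spanned by `x` and `y` from which both points lie inward
  set x₀ : Fin m → ℝ := fun a => if min (x a) (y a) ≤ 1 / 2 then min (x a) (y a)
    else max (x a) (y a) with hx₀def
  have hx₀ : x₀ ∈ Set.Icc (0 : Fin m → ℝ) 1 := by
    constructor <;> intro a <;> simp only [x₀]
    · split_ifs
      · exact le_min (hx.1 a) (hy.1 a)
      · exact (hx.1 a).trans (le_max_left _ _)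
    · split_ifs
      · exact (min_le_left _ _).trans (hx.2 a)
      · exact max_le (hx.2 a) (hy.2 a)
  have hinx : Inward x₀ (x - x₀) := by
    intro a
    simp only [x₀, Pi.sub_apply]
    split_ifs with h
    · exact Or.inl ⟨h, by linarith [min_le_left (x a) (y a)]⟩
    · exact Or.inr ⟨by linarith [min_le_max (a := x a) (b := y a)],
        by linarith [le_max_left (x a) (y a)]⟩
  have hiny : Inward x₀ (y - x₀) := by
    intro a
    simp only [x₀, Pi.sub_apply]
    split_ifs with h
    · exact Or.inl ⟨h, by linarith [min_le_right (x a) (y a)]⟩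
    · exact Or.inr ⟨by linarith [min_le_max (a := x a) (b := y a)],
        by linarith [le_max_right (x a) (y a)]⟩
  have hnx : ‖x - x₀‖ ≤ ‖x - y‖ := by
    refine (pi_norm_le_iff_of_nonneg (norm_nonneg _)).2 fun a => ?_
    refine le_trans ?_ (norm_le_pi_norm (x - y) a)
    simp only [x₀, Pi.sub_apply, Real.norm_eq_abs]
    rcases le_total (x a) (y a) with h | h <;> split_ifs <;> simp [h]
  have hny : ‖y - x₀‖ ≤ ‖x - y‖ := by
    refine (pi_norm_le_iff_of_nonneg (norm_nonneg _)).2 fun a => ?_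
    refine le_trans ?_ (norm_le_pi_norm (x - y) a)
    simp only [x₀, Pi.sub_apply, Real.norm_eq_abs]
    rcases le_total (x a) (y a) with h | h <;> split_ifs <;> simp [h, abs_sub_comm]
  obtain ⟨Q, hQ, hQx⟩ := hK f hf hM 0 x₀ hx₀
  have hconst : ∀ z : Fin m → ℝ, MvPolynomial.eval z Q = MvPolynomial.coeff 0 Q := by
    intro z
    rw [(MvPolynomial.totalDegree_eq_zero_iff_eq_C (p := Q)).1 (by omega)]
    simp
  have h1 := hQx x hx hinx
  have h2 := hQx y hy hiny
  rw [hconst, Nat.cast_zero, zero_add] at h1 h2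
  have hs : 0 ≤ min α 1 := le_min hα zero_le_one
  have h3 : K * ‖x - x₀‖ ^ min α 1 ≤ K * ‖x - y‖ ^ min α 1 := by gcongr
  have h4 : K * ‖y - x₀‖ ^ min α 1 ≤ K * ‖x - y‖ ^ min α 1 := by gcongr
  have h5 := abs_le.1 (h1.trans h3)
  have h6 := abs_le.1 (h2.trans h4)
  exact abs_le.2 ⟨by linarith, by linarith⟩

end

/-! ### Block polynomial tensors -/

section

variable {m d : ℕ}

theorem totalDegree_aeval_le {Q : MvPolynomial (Fin m) ℝ} {ℓ : ℕ} (hQ : Q.totalDegree ≤ ℓ)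
    (g : Fin m → MvPolynomial (Fin m) ℝ) (hg : ∀ a, (g a).totalDegree ≤ 1) :
    (MvPolynomial.aeval g Q).totalDegree ≤ ℓ := by
  rw [MvPolynomial.aeval_def, MvPolynomial.eval₂_eq]
  refine MvPolynomial.totalDegree_finsetSum_le fun s hs => ?_
  refine (MvPolynomial.totalDegree_mul _ _).trans ?_
  rw [MvPolynomial.algebraMap_eq, MvPolynomial.totalDegree_C, zero_add]
  refine (MvPolynomial.totalDegree_finsetProd _ _).trans ?_
  refine le_trans ?_ ((MvPolynomial.le_totalDegree hs).trans hQ)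
  refine Finset.sum_le_sum fun a _ => ?_
  refine (MvPolynomial.totalDegree_pow _ _).trans ?_
  exact (Nat.mul_le_mul_left _ (hg a)).trans (by simp)

theorem cluster_bounds {k : ℕ} (hk : 1 ≤ k) (i : Fin d) :
    1 ≤ cluster d k i ∧ cluster d k i ≤ k ∧
      ((cluster d k i : ℝ) - 1) / k ≤ ((i : ℕ) + 1 : ℝ) / d ∧
      ((i : ℕ) + 1 : ℝ) / d ≤ (cluster d k i : ℝ) / k := by
  have hd : (0 : ℝ) < d := by exact_mod_cast i.pos
  have hk' : (0 : ℝ) < k := by exact_mod_cast hk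
  have hpos : 0 < (k : ℝ) * (((i : ℕ) : ℝ) + 1) / (d : ℝ) := by positivity
  refine ⟨Nat.ceil_pos.2 hpos, ?_, ?_, ?_⟩
  · refine Nat.ceil_le.2 ?_
    rw [div_le_iff₀ hd]
    have : ((i : ℕ) : ℝ) + 1 ≤ d := by exact_mod_cast i.2
    gcongr
  · have h := Nat.ceil_lt_add_one hpos.le
    rw [div_le_iff₀ hk']
    have h2 : (cluster d k i : ℝ) < (k : ℝ) * (((i : ℕ) : ℝ) + 1) / (d : ℝ) + 1 := h
    have h3 : (k : ℝ) * (((i : ℕ) : ℝ) + 1) / (d : ℝ) = (((i : ℕ) : ℝ) + 1) / d * k := by ring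
    linarith
  · have h := Nat.le_ceil ((k : ℝ) * (((i : ℕ) : ℝ) + 1) / (d : ℝ))
    rw [le_div_iff₀ hk']
    have h2 : (k : ℝ) * (((i : ℕ) : ℝ) + 1) / (d : ℝ) ≤ (cluster d k i : ℝ) := h
    have h3 : (k : ℝ) * (((i : ℕ) : ℝ) + 1) / (d : ℝ) = (((i : ℕ) : ℝ) + 1) / d * k := by ring
    linarith

/-- The point of the unit cube that corresponds to a multi-index. -/
def gridPoint (i : Fin m → Fin d) : Fin m → ℝ := fun a => (((i a : ℕ) : ℝ) + 1) / (d : ℝ)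

theorem signal_apply (f : (Fin m → ℝ) → ℝ) (i : Fin m → Fin d) :
    signal d f i = f (gridPoint i) := rfl

theorem gridPoint_mem (i : Fin m → Fin d) : gridPoint i ∈ Set.Icc (0 : Fin m → ℝ) 1 := by
  refine ⟨fun a => ?_, fun a => ?_⟩
  · simp only [gridPoint, Pi.zero_apply]
    positivity
  · have hd : (0 : ℝ) < d := by exact_mod_cast (i a).pos
    simp only [gridPoint, Pi.one_apply]
    rw [div_le_one hd]
    exact_mod_cast (i a).2

/-- The signal tensor is approximated entrywise by a block-`k` degree-`ℓ` tensor with error of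
order `k ^ (-min α (ℓ + 1))`. -/
theorem exists_blockPoly_approx (α L M : ℝ) (hα : 0 ≤ α) (hL : 0 < L) :
    ∃ K : ℝ, 0 ≤ K ∧ ∀ f : (Fin m → ℝ) → ℝ, IsHolderSmooth α L f →
      (∀ x ∈ Set.Icc (0 : Fin m → ℝ) 1, ∀ y ∈ Set.Icc (0 : Fin m → ℝ) 1, |f x - f y| ≤ M) →
      ∀ (d k ℓ : ℕ), 1 ≤ k → ∃ B ∈ blockPoly m d k ℓ, ∀ ω,
        |signal d f ω - B ω| ≤ K * (1 / (k : ℝ)) ^ min α ((ℓ : ℝ) + 1) := by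
  classical
  obtain ⟨K, hK0, hK⟩ := exists_local_approx (m := m) α L M hα hL
  refine ⟨K, hK0, fun f hf hM d k ℓ hk => ?_⟩
  have hk' : (0 : ℝ) < k := by exact_mod_cast hk
  have happrox : ∀ x₀ : Fin m → ℝ, ∃ Q : MvPolynomial (Fin m) ℝ, Q.totalDegree ≤ ℓ ∧
      (x₀ ∈ Set.Icc (0 : Fin m → ℝ) 1 → ∀ x ∈ Set.Icc (0 : Fin m → ℝ) 1, Inward x₀ (x - x₀) →
        |f x - MvPolynomial.eval (x - x₀) Q| ≤ K * ‖x - x₀‖ ^ min α ((ℓ : ℝ) + 1)) := by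
    intro x₀
    by_cases hx₀ : x₀ ∈ Set.Icc (0 : Fin m → ℝ) 1
    · obtain ⟨Q, h1, h2⟩ := hK f hf hM ℓ x₀ hx₀
      exact ⟨Q, h1, fun _ => h2⟩
    · exact ⟨0, by simp, fun h => absurd h hx₀⟩
  choose Q hQdeg hQ using happrox
  -- the corner of a block from which the block lies inward
  set corner : (Fin m → ℕ) → Fin m → ℝ := fun b a =>
    if ((b a : ℝ) - 1) / k ≤ 1 / 2 then ((b a : ℝ) - 1) / k else (b a : ℝ) / k
  set P : (Fin m → ℕ) → MvPolynomial (Fin m) ℝ := fun b =>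
    MvPolynomial.aeval (fun a => MvPolynomial.C (1 / (d : ℝ)) * MvPolynomial.X a -
      MvPolynomial.C (corner b a)) (Q (corner b))
  have hevalP : ∀ b (x : Fin m → ℝ), MvPolynomial.eval x (P b) =
      MvPolynomial.eval (fun a => 1 / (d : ℝ) * x a - corner b a) (Q (corner b)) := by
    intro b x
    simp only [P, MvPolynomial.aeval_def, MvPolynomial.eval₂_eq, map_sum, map_mul, map_prod,
      map_pow, map_sub, MvPolynomial.algebraMap_eq, MvPolynomial.eval_C, MvPolynomial.eval_X]
    rw [MvPolynomial.eval_eq]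
  refine ⟨fun ω => MvPolynomial.eval (fun a => ((ω a : ℕ) : ℝ) + 1)
    (P (fun a => cluster d k (ω a))), ⟨P, fun b => ?_, fun ω => rfl⟩, fun ω => ?_⟩
  · refine totalDegree_aeval_le (hQdeg _) _ fun a => ?_
    refine (MvPolynomial.totalDegree_sub_C_le _ _).trans ?_
    refine (MvPolynomial.totalDegree_mul _ _).trans ?_
    simp
  · set b : Fin m → ℕ := fun a => cluster d k (ω a)
    have hcl := fun a => cluster_bounds hk (ω a)
    have hb1 : ∀ a, (1 : ℝ) ≤ b a := fun a => by exact_mod_cast (hcl a).1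
    have hbk : ∀ a, (b a : ℝ) ≤ k := fun a => by exact_mod_cast (hcl a).2.1
    have hstep : ∀ a, (b a : ℝ) / k = ((b a : ℝ) - 1) / k + 1 / k := fun a => by ring
    have hlow : ∀ a, ((b a : ℝ) - 1) / k ≤ gridPoint ω a := fun a => (hcl a).2.2.1
    have hupp : ∀ a, gridPoint ω a ≤ (b a : ℝ) / k := fun a => (hcl a).2.2.2
    have h0 : ∀ a, 0 ≤ ((b a : ℝ) - 1) / k := fun a =>
      div_nonneg (by linarith [hb1 a]) hk'.le
    have h1 : ∀ a, (b a : ℝ) / k ≤ 1 := fun a => (div_le_one hk').2 (hbk a)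
    have hkinv : 0 < 1 / (k : ℝ) := by positivity
    have hin : Inward (corner b) (gridPoint ω - corner b) := by
      intro a
      simp only [corner, Pi.sub_apply]
      have := hstep a
      split_ifs with h
      · exact Or.inl ⟨h, by linarith [hlow a]⟩
      · exact Or.inr ⟨by linarith, by linarith [hupp a]⟩
    have hmem : corner b ∈ Set.Icc (0 : Fin m → ℝ) 1 := by
      constructor <;> intro a <;> simp only [corner, Pi.zero_apply, Pi.one_apply] <;>
        have := hstep a <;> have := h0 a <;> have := h1 a <;> split_ifs <;> linarith
    have hnorm : ‖gridPoint ω - corner b‖ ≤ 1 / k := by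
      refine (pi_norm_le_iff_of_nonneg hkinv.le).2 fun a => ?_
      simp only [corner, Pi.sub_apply, Real.norm_eq_abs]
      have := hstep a
      have := hlow a
      have := hupp a
      split_ifs <;> rw [abs_le] <;> constructor <;> linarith
    have h := hQ _ hmem _ (gridPoint_mem ω) hin
    have hev : MvPolynomial.eval (fun a => ((ω a : ℕ) : ℝ) + 1) (P b) =
        MvPolynomial.eval (gridPoint ω - corner b) (Q (corner b)) := by
      rw [hevalP]
      congr 2
      ext a
      simp only [gridPoint, Pi.sub_apply]
      ring
    rw [signal_apply]
    refine (hev ▸ h :).trans ?_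
    have hs : 0 ≤ min α ((ℓ : ℝ) + 1) := le_min hα (by positivity)
    gcongr

/-- A monomial of degree at most `ℓ` is a product of `ℓ` factors from `{1, x₁, …, xₘ}`; `none`
stands for the factor `1`. -/
theorem exists_prod_eq_monomial (ℓ : ℕ) : ∀ s : Fin m →₀ ℕ, s.degree ≤ ℓ →
    ∃ h : Fin ℓ → Option (Fin m), ∀ x : Fin m → ℝ,
      ∏ a, x a ^ s a = ∏ j, (h j).elim 1 x := by
  induction ℓ with
  | zero =>
    intro s hs
    have : s = 0 := by
      rw [← Finsupp.degree_eq_zero_iff]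
      omega
    exact ⟨fun _ => none, fun x => by simp [this]⟩
  | succ ℓ ih =>
    intro s hs
    by_cases hs0 : s = 0
    · exact ⟨fun _ => none, fun x => by simp [hs0]⟩
    · obtain ⟨a, ha⟩ := Finsupp.ne_iff.1 hs0
      rw [Finsupp.coe_zero, Pi.zero_apply] at ha
      have hsplit : s = Finsupp.single a 1 + (s - Finsupp.single a 1) := by
        rw [add_tsub_cancel_of_le]
        rw [Finsupp.single_le_iff]
        omega
      obtain ⟨h, hh⟩ := ih (s - Finsupp.single a 1) (by
        have := congrArg Finsupp.degree hsplit
        rw [map_add, Finsupp.degree_single] at this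
        omega)
      refine ⟨Fin.cons (some a) h, fun x => ?_⟩
      rw [Fin.prod_univ_succ]
      simp only [Fin.cons_zero, Fin.cons_succ, Option.elim_some]
      rw [← hh x]
      conv_lhs => rw [hsplit]
      simp only [Finsupp.coe_add, Pi.add_apply, pow_add, Finset.prod_mul_distrib]
      congr 1
      rw [Finset.prod_eq_single a]
      · simp
      · intro b _ hb
        simp [hb.symm]
      · simp

/-- The linear space of block-`k` degree-`ℓ` tensors. -/
def blockSubmodule (m d k ℓ : ℕ) : Submodule ℝ (Tensor m d) where
  carrier := blockPoly m d k ℓ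
  zero_mem' := ⟨fun _ => 0, fun _ => by simp, fun _ => by simp⟩
  add_mem' := by
    rintro B₁ B₂ ⟨P₁, h₁, e₁⟩ ⟨P₂, h₂, e₂⟩
    refine ⟨fun b => P₁ b + P₂ b, fun b => ?_, fun ω => by simp [e₁, e₂]⟩
    exact (MvPolynomial.totalDegree_add _ _).trans (max_le (h₁ b) (h₂ b))
  smul_mem' := by
    rintro c B ⟨P, h, e⟩
    refine ⟨fun b => c • P b, fun b => ?_, fun ω => by simp [e]⟩
    exact (MvPolynomial.totalDegree_smul_le _ _).trans (h b)

/-- The products of `ℓ` factors from `{1, x₁, …, xₘ}`, restricted to a block: they span the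
block-`k` degree-`ℓ` tensors. -/
def blockMonomial (d : ℕ) {k ℓ : ℕ} (q : (Fin m → Fin k) × (Fin ℓ → Option (Fin m))) :
    Tensor m d := fun ω =>
  if ∀ a, cluster d k (ω a) = (q.1 a : ℕ) + 1 then
    ∏ j, (q.2 j).elim 1 (fun a => ((ω a : ℕ) : ℝ) + 1) else 0

theorem blockSubmodule_le_span {k : ℕ} (hk : 1 ≤ k) (ℓ : ℕ) :
    blockSubmodule m d k ℓ ≤
      Submodule.span ℝ (Set.range (blockMonomial (m := m) (k := k) (ℓ := ℓ) d)) := by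
  classical
  rintro B ⟨P, hP, hB⟩
  have hdecomp : B = ∑ b : Fin m → Fin k, ∑ s ∈ (P (fun a => (b a : ℕ) + 1)).support,
      (P (fun a => (b a : ℕ) + 1)).coeff s • (fun ω : Fin m → Fin d =>
        if ∀ a, cluster d k (ω a) = (b a : ℕ) + 1 then
          ∏ a, (((ω a : ℕ) : ℝ) + 1) ^ s a else 0) := by
    ext ω
    have hcl := fun a => cluster_bounds hk (ω a)
    set b₀ : Fin m → Fin k := fun a => ⟨cluster d k (ω a) - 1, by
      have := (hcl a).1
      have := (hcl a).2.1
      omega⟩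
    have hb₀ : ∀ a, cluster d k (ω a) = (b₀ a : ℕ) + 1 := fun a => by
      have := (hcl a).1
      simp only [b₀]
      omega
    rw [Finset.sum_apply, Finset.sum_eq_single b₀]
    · simp only [Finset.sum_apply, Pi.smul_apply, smul_eq_mul, if_pos hb₀]
      rw [hB, MvPolynomial.eval_eq']
      simp only [hb₀]
    · intro b _ hb
      have : ¬ ∀ a, cluster d k (ω a) = (b a : ℕ) + 1 := fun h => hb (by
        ext a
        have := h a
        have := hb₀ a
        omega)
      simp [if_neg this]
    · simp
  rw [hdecomp]
  refine Submodule.sum_mem _ fun b _ => Submodule.sum_mem _ fun s hs => Submodule.smul_mem _ _ ?_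
  have hdeg : s.degree ≤ ℓ := (MvPolynomial.le_totalDegree hs).trans (hP _)
  obtain ⟨h, hh⟩ := exists_prod_eq_monomial ℓ s hdeg
  refine Submodule.subset_span ⟨(b, h), ?_⟩
  ext ω
  simp only [blockMonomial, hh]

theorem finrank_blockSubmodule_le {k : ℕ} (hk : 1 ≤ k) (ℓ : ℕ) :
    Module.finrank ℝ (blockSubmodule m d k ℓ) ≤ k ^ m * (m + 1) ^ ℓ := by
  classical
  refine (Submodule.finrank_mono (blockSubmodule_le_span hk ℓ)).trans ?_
  refine (finrank_range_le_card (R := ℝ) (blockMonomial (m := m) (k := k) (ℓ := ℓ) d)).trans ?_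
  simp

/-- An orthonormal basis `u` of a subspace `V` of `ℝ^ι`, together with the Cauchy–Schwarz bound
`⟨v, e⟩² ≤ ‖v‖² ‖proj_V e‖²` for `v ∈ V`, the projection being expressed in the basis. -/
theorem exists_orthonormal_family {ι : Type*} [Fintype ι] (V : Submodule ℝ (ι → ℝ)) :
    ∃ u : Fin (Module.finrank ℝ V) → ι → ℝ,
      (∀ k l, ∑ i, u k i * u l i = if k = l then 1 else 0) ∧
      ∀ v ∈ V, ∀ e : ι → ℝ,
        (∑ i, v i * e i) ^ 2 ≤ (∑ i, v i ^ 2) * ∑ k, (∑ i, u k i * e i) ^ 2 := by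
  set W : Submodule ℝ (EuclideanSpace ℝ ι) :=
    V.map (WithLp.linearEquiv 2 ℝ (ι → ℝ)).symm.toLinearMap
  have hW : Module.finrank ℝ W = Module.finrank ℝ V :=
    LinearEquiv.finrank_map_eq (WithLp.linearEquiv 2 ℝ (ι → ℝ)).symm V
  set b := (stdOrthonormalBasis ℝ W).reindex (finCongr hW)
  have hinner : ∀ x y : EuclideanSpace ℝ ι, inner ℝ x y = ∑ i, x i * y i := by
    intro x y
    simp [PiLp.inner_apply, mul_comm]
  refine ⟨fun k i => (b k : EuclideanSpace ℝ ι) i, fun k l => ?_, fun v hv e => ?_⟩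
  · rw [← hinner, ← Submodule.coe_inner]
    exact (orthonormal_iff_ite.1 b.orthonormal) k l
  · set v' : W := ⟨WithLp.toLp 2 v, v, hv, rfl⟩
    set e' : EuclideanSpace ℝ ι := WithLp.toLp 2 e
    have h1 : ∑ i, v i * e i = ∑ k, inner ℝ v' (b k) * ∑ i, (b k : EuclideanSpace ℝ ι) i * e i := by
      have h2 : (v' : EuclideanSpace ℝ ι) = ∑ k, inner ℝ (b k) v' • (b k : EuclideanSpace ℝ ι) := by
        conv_lhs => rw [← b.sum_repr' v']
        simp
      have h3 : ∑ i, v i * e i = inner ℝ (v' : EuclideanSpace ℝ ι) e' := by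
        rw [hinner]
      rw [h3, h2, sum_inner]
      refine Finset.sum_congr rfl fun k _ => ?_
      rw [real_inner_smul_left, hinner, real_inner_comm]
    have h4 : ∑ i, v i ^ 2 = ∑ k, inner ℝ v' (b k) ^ 2 := by
      have h5 : ∑ i, v i ^ 2 = ‖v'‖ ^ 2 := by
        rw [← real_inner_self_eq_norm_sq, Submodule.coe_inner, hinner]
        simp [v', sq]
      rw [h5, ← b.sum_sq_norm_inner_left v']
      simp [sq_abs]
    rw [h1, h4]
    exact Finset.sum_mul_sq_le_sq_mul_sq _ _ _

end

/-! ### Concentration of projected sub-Gaussian noise and of its scores -/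

section

theorem lintegral_exp_mul_gaussianReal (x : ℝ) :
    ∫⁻ g, ENNReal.ofReal (Real.exp (x * g)) ∂(gaussianReal 0 1) =
      ENNReal.ofReal (Real.exp (x ^ 2 / 2)) := by
  rw [← ofReal_integral_eq_lintegral_ofReal (integrable_exp_mul_gaussianReal x)
    (ae_of_all _ fun _ => (Real.exp_pos _).le)]
  have h := mgf_gaussianReal (p := gaussianReal 0 1) (X := id) (μ := 0) (v := 1)
    Measure.map_id x
  rw [mgf] at h
  simp only [id] at h
  rw [h]
  congr 2
  push_cast
  ring

theorem lintegral_exp_sq_gaussianReal :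
    ∫⁻ g, ENNReal.ofReal (Real.exp (g ^ 2 / 4)) ∂(gaussianReal 0 1) ≤
      ENNReal.ofReal (Real.exp (1 / 2)) := by
  rw [gaussianReal_of_var_ne_zero 0 one_ne_zero,
    lintegral_withDensity_eq_lintegral_mul _ (measurable_gaussianPDF 0 1) (by fun_prop)]
  have hfun : ∀ g : ℝ, (gaussianPDF 0 1 * fun g : ℝ => ENNReal.ofReal (Real.exp (g ^ 2 / 4))) g =
      ENNReal.ofReal ((√(2 * Real.pi))⁻¹ * Real.exp (-(1 / 4) * g ^ 2)) := by
    intro g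
    rw [Pi.mul_apply, gaussianPDF, ← ENNReal.ofReal_mul (gaussianPDFReal_nonneg _ _ _),
      gaussianPDFReal_def, mul_assoc, ← Real.exp_add]
    congr 2
    · simp
    · congr 1
      simp
      ring
  simp_rw [hfun]
  rw [← ofReal_integral_eq_lintegral_ofReal
    ((integrable_exp_neg_mul_sq (by norm_num : (0 : ℝ) < 1 / 4)).const_mul _)
    (ae_of_all _ fun _ => by positivity), integral_const_mul, integral_gaussian]
  refine ENNReal.ofReal_le_ofReal ?_
  have h1 : (√(2 * Real.pi))⁻¹ * √(Real.pi / (1 / 4)) = √2 := by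
    rw [← Real.sqrt_inv, ← Real.sqrt_mul (by positivity)]
    congr 1
    field_simp
    norm_num
  rw [h1, Real.sqrt_le_left (Real.exp_pos _).le, ← Real.exp_nat_mul]
  have := Real.add_one_le_exp (1 : ℝ)
  norm_num
  linarith

theorem lintegral_pi_prod {κ : Type*} [Fintype κ] (γ : Measure ℝ) [IsProbabilityMeasure γ]
    (F : κ → ℝ → ℝ≥0∞) (hF : ∀ k, Measurable (F k)) :
    ∫⁻ g, ∏ k, F k (g k) ∂(Measure.pi fun _ : κ => γ) = ∏ k, ∫⁻ x, F k x ∂γ := by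
  refine (lintegral_prod_eq_prod_lintegral_of_indepFun Finset.univ
    (fun k (g : κ → ℝ) => F k (g k)) (iIndepFun_pi fun k => (hF k).aemeasurable)
    (fun k => (hF k).comp (measurable_pi_apply k))).trans ?_
  refine Finset.prod_congr rfl fun k _ => ?_
  exact (measurePreserving_eval (fun _ : κ => γ) k).lintegral_comp (hF k)

variable {Ω : Type*} [MeasurableSpace Ω] {μ : Measure Ω}

theorem lintegral_exp_sum_mul_le {ι : Type*} [Fintype ι] {ξ : ι → Ω → ℝ}
    (hind : iIndepFun ξ μ) {v : ℝ≥0} (hsub : ∀ i, HasSubgaussianMGF (ξ i) v μ) (a : ι → ℝ) :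
    ∫⁻ ω, ENNReal.ofReal (Real.exp (∑ i, a i * ξ i ω)) ∂μ ≤
      ENNReal.ofReal (Real.exp (v * (∑ i, a i ^ 2) / 2)) := by
  have h := HasSubgaussianMGF.sum_of_iIndepFun (s := Finset.univ)
    (hind.comp (fun i x => a i * x) fun i => measurable_const_mul _)
    (fun i _ => (hsub i).const_mul (a i))
  have h1 := h.mgf_le 1
  have h2 := h.integrable_exp_mul 1
  simp only [mgf, one_mul, Function.comp_apply] at h1 h2
  rw [← ofReal_integral_eq_lintegral_ofReal h2 (ae_of_all _ fun _ => (Real.exp_pos _).le)]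
  refine ENNReal.ofReal_le_ofReal (h1.trans (le_of_eq ?_))
  congr 1
  push_cast
  rw [Finset.mul_sum, one_pow, mul_one]
  congr 1
  exact Finset.sum_congr rfl fun i _ => mul_comm _ _

/-- The squared norm of the projection of sub-Gaussian noise on an `N`-dimensional space has an
exponential moment `exp (N / 2)`. The square in the exponent is linearised by an independent
standard Gaussian vector `g`, with `exp (x² / 2) = E exp (x g)`; after exchanging the expectations,
the sub-Gaussian bound applies for each value of `g`. -/
theorem lintegral_exp_sum_sq_le {ι : Type*} [Fintype ι] {ξ : ι → Ω → ℝ} [IsProbabilityMeasure μ]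
    (hind : iIndepFun ξ μ) {v : ℝ≥0} (hv : 0 < v) (hsub : ∀ i, HasSubgaussianMGF (ξ i) v μ)
    {N : ℕ} (u : Fin N → ι → ℝ) (hu : ∀ k l, ∑ i, u k i * u l i = if k = l then 1 else 0) :
    ∫⁻ ω, ENNReal.ofReal (Real.exp ((∑ k, (∑ i, u k i * ξ i ω) ^ 2) / (4 * v))) ∂μ ≤
      ENNReal.ofReal (Real.exp (N / 2)) := by
  have hv' : (0 : ℝ) < v := by exact_mod_cast hv
  -- the scale at which the Gaussian vector gets the exponential moment of `g² / 4`
  set r : ℝ := √(1 / (2 * v))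
  have hr : r ^ 2 = 1 / (2 * v) := Real.sq_sqrt (by positivity)
  have hlin : ∀ ω, ENNReal.ofReal (Real.exp ((∑ k, (∑ i, u k i * ξ i ω) ^ 2) / (4 * v))) =
      ∫⁻ g, ENNReal.ofReal (Real.exp (∑ i, (∑ k, r * g k * u k i) * ξ i ω))
        ∂(Measure.pi fun _ : Fin N => gaussianReal 0 1) := by
    intro ω
    have h1 : ∀ g : Fin N → ℝ,
        ENNReal.ofReal (Real.exp (∑ i, (∑ k, r * g k * u k i) * ξ i ω)) =
        ∏ k, ENNReal.ofReal (Real.exp ((r * ∑ i, u k i * ξ i ω) * g k)) := by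
      intro g
      rw [← ENNReal.ofReal_prod_of_nonneg (fun _ _ => (Real.exp_pos _).le), ← Real.exp_sum]
      congr 2
      simp only [Finset.sum_mul, Finset.mul_sum]
      rw [Finset.sum_comm]
      refine Finset.sum_congr rfl fun k _ => Finset.sum_congr rfl fun i _ => by ring
    simp_rw [h1]
    rw [lintegral_pi_prod (gaussianReal 0 1)
      (fun k x => ENNReal.ofReal (Real.exp ((r * ∑ i, u k i * ξ i ω) * x)))
      (fun k => by fun_prop)]
    simp_rw [lintegral_exp_mul_gaussianReal]
    rw [← ENNReal.ofReal_prod_of_nonneg (fun _ _ => (Real.exp_pos _).le), ← Real.exp_sum]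
    congr 2
    rw [Finset.sum_div]
    refine Finset.sum_congr rfl fun k _ => ?_
    rw [mul_pow, hr]
    field_simp
    ring
  simp_rw [hlin]
  have hmeas : ∀ i, AEMeasurable (ξ i) μ := fun i => (hsub i).aemeasurable
  rw [lintegral_lintegral_swap]
  · have h2 : ∀ g : Fin N → ℝ,
        ∫⁻ ω, ENNReal.ofReal (Real.exp (∑ i, (∑ k, r * g k * u k i) * ξ i ω)) ∂μ ≤
        ∏ k, ENNReal.ofReal (Real.exp (g k ^ 2 / 4)) := by
      intro g
      refine (lintegral_exp_sum_mul_le hind hsub _).trans (le_of_eq ?_)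
      rw [← ENNReal.ofReal_prod_of_nonneg (fun _ _ => (Real.exp_pos _).le), ← Real.exp_sum]
      congr 2
      have h3 : ∑ i, (∑ k, r * g k * u k i) ^ 2 = ∑ k, r ^ 2 * g k ^ 2 := by
        calc ∑ i, (∑ k, r * g k * u k i) ^ 2
            = ∑ i, ∑ k, ∑ l, (r * g k * (r * g l)) * (u k i * u l i) := by
              refine Finset.sum_congr rfl fun i _ => ?_
              rw [sq, Finset.sum_mul_sum]
              refine Finset.sum_congr rfl fun k _ => Finset.sum_congr rfl fun l _ => by ring
          _ = ∑ k, ∑ l, (r * g k * (r * g l)) * ∑ i, u k i * u l i := by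
              rw [Finset.sum_comm]
              refine Finset.sum_congr rfl fun k _ => ?_
              rw [Finset.sum_comm]
              refine Finset.sum_congr rfl fun l _ => ?_
              rw [Finset.mul_sum]
          _ = _ := by
              refine Finset.sum_congr rfl fun k _ => ?_
              simp only [hu, mul_ite, mul_one, mul_zero, Finset.sum_ite_eq, Finset.mem_univ,
                if_true]
              ring
      rw [h3, hr, ← Finset.mul_sum, ← Finset.sum_div]
      field_simp
      ring
    refine (lintegral_mono h2).trans ?_
    rw [lintegral_pi_prod (gaussianReal 0 1) (fun _ x => ENNReal.ofReal (Real.exp (x ^ 2 / 4)))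
      (fun k => by fun_prop)]
    refine (Finset.prod_le_prod' fun k _ => lintegral_exp_sq_gaussianReal).trans (le_of_eq ?_)
    rw [Finset.prod_const, ← ENNReal.ofReal_pow (Real.exp_pos _).le, ← Real.exp_nat_mul]
    simp [div_eq_mul_inv]
  · refine ENNReal.measurable_ofReal.comp_aemeasurable (Real.measurable_exp.comp_aemeasurable ?_)
    refine Finset.aemeasurable_fun_sum _ fun i _ => ?_
    refine AEMeasurable.mul ?_ (hmeas i).comp_fst
    exact Measurable.aemeasurable (by fun_prop)

theorem measure_sum_sq_gt_le {ι : Type*} [Fintype ι] {ξ : ι → Ω → ℝ} [IsProbabilityMeasure μ]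
    (hind : iIndepFun ξ μ) {v : ℝ≥0} (hv : 0 < v) (hsub : ∀ i, HasSubgaussianMGF (ξ i) v μ)
    {N : ℕ} (u : Fin N → ι → ℝ) (hu : ∀ k l, ∑ i, u k i * u l i = if k = l then 1 else 0)
    (t : ℝ) :
    μ {ω | 4 * v * t < ∑ k, (∑ i, u k i * ξ i ω) ^ 2} ≤
      ENNReal.ofReal (Real.exp (N / 2 - t)) := by
  have hv' : (0 : ℝ) < v := by exact_mod_cast hv
  have hmeas : ∀ i, AEMeasurable (ξ i) μ := fun i => (hsub i).aemeasurable
  have hsubset : {ω | 4 * v * t < ∑ k, (∑ i, u k i * ξ i ω) ^ 2} ⊆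
      {ω | ENNReal.ofReal (Real.exp t) ≤
        ENNReal.ofReal (Real.exp ((∑ k, (∑ i, u k i * ξ i ω) ^ 2) / (4 * v)))} := by
    intro ω hω
    refine ENNReal.ofReal_le_ofReal (Real.exp_le_exp.2 ?_)
    rw [le_div_iff₀ (by positivity)]
    have h : 4 * v * t < ∑ k, (∑ i, u k i * ξ i ω) ^ 2 := hω
    linarith
  refine (measure_mono hsubset).trans ?_
  refine (meas_ge_le_lintegral_div ?_ (by simpa using Real.exp_pos t)
    ENNReal.ofReal_ne_top).trans ?_
  · refine ENNReal.measurable_ofReal.comp_aemeasurable (Real.measurable_exp.comp_aemeasurable ?_)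
    refine AEMeasurable.div_const ?_ _
    refine Finset.aemeasurable_fun_sum _ fun k _ => AEMeasurable.pow_const ?_ _
    exact Finset.aemeasurable_fun_sum _ fun i _ => (hmeas i).const_mul _
  · rw [Real.exp_sub, ENNReal.ofReal_div_of_pos (Real.exp_pos t)]
    gcongr
    exact lintegral_exp_sum_sq_le hind hv hsub u hu

variable {m d : ℕ}

/-- The bound for the projected noise, uniformly over the permutations of the index set: there are
`d! ≤ exp (d log d)` of them. -/
theorem measure_exists_perm_gt_le {ξ : (Fin m → Fin d) → Ω → ℝ} [IsProbabilityMeasure μ]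
    (hind : iIndepFun ξ μ) {v : ℝ≥0} (hv : 0 < v) (hsub : ∀ i, HasSubgaussianMGF (ξ i) v μ)
    {N : ℕ} (u : Fin N → (Fin m → Fin d) → ℝ)
    (hu : ∀ k l, ∑ i, u k i * u l i = if k = l then 1 else 0) (hd : 1 ≤ d) (t : ℝ) :
    μ {ω | ∃ ρ : Equiv.Perm (Fin d),
        4 * v * t < ∑ k, (∑ i, u k i * ξ (fun a => ρ (i a)) ω) ^ 2} ≤
      ENNReal.ofReal (Real.exp (d * Real.log d + N / 2 - t)) := by
  have hset : {ω | ∃ ρ : Equiv.Perm (Fin d),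
        4 * v * t < ∑ k, (∑ i, u k i * ξ (fun a => ρ (i a)) ω) ^ 2} =
      ⋃ ρ : Equiv.Perm (Fin d),
        {ω | 4 * v * t < ∑ k, (∑ i, u k i * ξ (fun a => ρ (i a)) ω) ^ 2} := by
    ext ω
    simp
  rw [hset]
  refine (measure_iUnion_fintype_le _ _).trans ?_
  have h1 : ∀ ρ : Equiv.Perm (Fin d),
      μ {ω | 4 * v * t < ∑ k, (∑ i, u k i * ξ (fun a => ρ (i a)) ω) ^ 2} ≤
        ENNReal.ofReal (Real.exp (N / 2 - t)) := by
    intro ρ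
    refine measure_sum_sq_gt_le (ξ := fun i : Fin m → Fin d => ξ (fun a => ρ (i a)))
      (hind.precomp (g := fun i : Fin m → Fin d => fun a => ρ (i a)) ?_) hv (fun i => hsub _) u hu t
    intro i j hij
    ext a
    exact congrArg _ (ρ.injective (congrFun hij a))
  refine (Finset.sum_le_sum fun ρ _ => h1 ρ).trans ?_
  rw [Finset.sum_const, Finset.card_univ, Fintype.card_perm, Fintype.card_fin, nsmul_eq_mul,
    ← ENNReal.ofReal_natCast, ← ENNReal.ofReal_mul (by positivity)]
  refine ENNReal.ofReal_le_ofReal ?_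
  have hd' : (0 : ℝ) < d := by exact_mod_cast hd
  have h2 : (d.factorial : ℝ) ≤ Real.exp (d * Real.log d) := by
    rw [Real.exp_nat_mul, Real.exp_log hd']
    exact_mod_cast Nat.factorial_le_pow d
  rw [add_sub_assoc, Real.exp_add]
  gcongr

theorem card_filter_apply_zero_eq [NeZero m] (i : Fin d) :
    (Finset.univ.filter fun ω : Fin m → Fin d => ω 0 = i).card = d ^ (m - 1) := by
  classical
  have h : (Finset.univ.filter fun ω : Fin m → Fin d => ω 0 = i) =
      Fintype.piFinset fun a : Fin m => if a = 0 then {i} else Finset.univ := by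
    ext ω
    simp only [Finset.mem_filter, Finset.mem_univ, true_and, Fintype.mem_piFinset]
    constructor
    · intro h a
      split_ifs with ha
      · simp [ha, h]
      · simp
    · intro h
      simpa using h 0
  rw [h, Fintype.card_piFinset, ← Finset.mul_prod_erase _ _ (Finset.mem_univ (0 : Fin m))]
  rw [Finset.prod_congr rfl (g := fun _ => d) (fun a ha => by
    simp [Finset.ne_of_mem_erase ha])]
  simp

theorem measure_exists_score_gt_le [NeZero m] {ξ : (Fin m → Fin d) → Ω → ℝ}
    [IsProbabilityMeasure μ] (hind : iIndepFun ξ μ) {v : ℝ≥0}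
    (hsub : ∀ i, HasSubgaussianMGF (ξ i) v μ) (hd : 1 ≤ d) {ε : ℝ} (hε : 0 ≤ ε) :
    μ {ω | ∃ i : Fin d, ε < |score (fun j => ξ j ω) i|} ≤
      ENNReal.ofReal (2 * d * Real.exp (-(ε ^ 2 * (d : ℝ) ^ (m - 1) / (2 * v)))) := by
  have hd' : (0 : ℝ) < (d : ℝ) ^ (m - 1) := by
    have : (0 : ℝ) < d := by exact_mod_cast hd
    positivity
  -- one-sided bound, for the noise and for its negative
  have key : ∀ ζ : (Fin m → Fin d) → Ω → ℝ, iIndepFun ζ μ → (∀ i, HasSubgaussianMGF (ζ i) v μ) →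
      ∀ i : Fin d, μ {ω | ε < score (fun j => ζ j ω) i} ≤
        ENNReal.ofReal (Real.exp (-(ε ^ 2 * (d : ℝ) ^ (m - 1) / (2 * v)))) := by
    intro ζ hζ hζsub i
    have h := HasSubgaussianMGF.measure_sum_ge_le_of_iIndepFun hζ
      (s := Finset.univ.filter fun ω : Fin m → Fin d => ω 0 = i) (fun j _ => hζsub j)
      (ε := ε * (d : ℝ) ^ (m - 1)) (by positivity)
    rw [Finset.sum_const, card_filter_apply_zero_eq, measureReal_def] at h
    have h2 := ENNReal.ofReal_le_ofReal h
    rw [ENNReal.ofReal_toReal (measure_ne_top _ _)] at h2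
    refine (measure_mono fun ω hω => ?_).trans (h2.trans (le_of_eq ?_))
    · have h3 : ε < score (fun j => ζ j ω) i := hω
      rw [score, lt_div_iff₀ hd'] at h3
      exact h3.le
    · congr 2
      push_cast
      rw [nsmul_eq_mul]
      push_cast
      rcases eq_or_ne (v : ℝ) 0 with hv | hv
      · simp [hv]
      · field_simp
  have hunion : {ω | ∃ i : Fin d, ε < |score (fun j => ξ j ω) i|} ⊆
      ⋃ i : Fin d, ({ω | ε < score (fun j => ξ j ω) i} ∪
        {ω | ε < score (fun j => (-ξ j) ω) i}) := by
    rintro ω ⟨i, hi⟩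
    refine Set.mem_iUnion.2 ⟨i, ?_⟩
    rcases lt_abs.1 hi with h | h
    · exact Or.inl h
    · refine Or.inr ?_
      have : score (fun j => (-ξ j) ω) i = - score (fun j => ξ j ω) i := by
        simp only [score, Pi.neg_apply, Finset.sum_neg_distrib, neg_div]
      rw [Set.mem_ofPred_eq, this]
      exact h
  refine (measure_mono hunion).trans ((measure_iUnion_fintype_le _ _).trans ?_)
  have hneg : iIndepFun (fun j => -ξ j) μ := hind.comp (fun _ x => -x) fun _ => measurable_neg
  refine (Finset.sum_le_sum fun i _ => (measure_union_le _ _).trans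
    (add_le_add (key ξ hind hsub i) (key _ hneg (fun j => (hsub j).neg) i))).trans (le_of_eq ?_)
  rw [Finset.sum_const, Finset.card_univ, Fintype.card_fin, nsmul_eq_mul,
    ← ENNReal.ofReal_add (by positivity) (by positivity), ← ENNReal.ofReal_natCast,
    ← ENNReal.ofReal_mul (by positivity)]
  congr 1
  ring

end

/-! ### Sorting by scores and least squares -/

section

variable {m d : ℕ}

/-- If a permutation moves `i` up, then it maps some larger index to `i` or below. -/
theorem exists_gt_apply_le (ρ : Equiv.Perm (Fin d)) {i : Fin d} (hi : i < ρ i) :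
    ∃ j, i < j ∧ ρ j ≤ i := by
  by_contra! h
  have hmaps : ∀ j ∈ Finset.Ici i, ρ j ∈ Finset.Ioi i := by
    intro j hj
    rw [Finset.mem_Ici] at hj
    rw [Finset.mem_Ioi]
    rcases hj.eq_or_lt with rfl | hj
    · exact hi
    · exact h j hj
  have hcard := Finset.card_le_card_of_injOn ρ hmaps ρ.injective.injOn
  rw [Fin.card_Ici, Fin.card_Ioi] at hcard
  omega

theorem exists_lt_le_apply (ρ : Equiv.Perm (Fin d)) {i : Fin d} (hi : ρ i < i) :
    ∃ j, j < i ∧ i ≤ ρ j := by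
  by_contra! h
  have hmaps : ∀ j ∈ Finset.Iic i, ρ j ∈ Finset.Iio i := by
    intro j hj
    rw [Finset.mem_Iic] at hj
    rw [Finset.mem_Iio]
    rcases hj.eq_or_lt with rfl | hj
    · exact hi
    · exact h j hj
  have hcard := Finset.card_le_card_of_injOn ρ hmaps ρ.injective.injOn
  rw [Fin.card_Iic, Fin.card_Iio] at hcard
  omega

/-- The displacement of a permutation is bounded by the size of its inversions. -/
theorem abs_apply_sub_div_le (ρ : Equiv.Perm (Fin d)) {Δ : ℝ} (hΔ : 0 ≤ Δ)
    (hinv : ∀ i j, i < j → ρ j < ρ i → (((ρ i : ℕ) : ℝ) - ((ρ j : ℕ) : ℝ)) / d ≤ Δ) (i : Fin d) :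
    |((ρ i : ℕ) : ℝ) - ((i : ℕ) : ℝ)| / d ≤ Δ := by
  rcases lt_trichotomy i (ρ i) with h | h | h
  · obtain ⟨j, hij, hj⟩ := exists_gt_apply_le ρ h
    refine le_trans ?_ (hinv i j hij (hj.trans_lt h))
    have h1 : ((i : ℕ) : ℝ) < (ρ i : ℕ) := by exact_mod_cast h
    have h2 : ((ρ j : ℕ) : ℝ) ≤ (i : ℕ) := by exact_mod_cast hj
    rw [abs_of_nonneg (by linarith)]
    gcongr
  · rw [← h]
    simpa using hΔ
  · obtain ⟨j, hji, hj⟩ := exists_lt_le_apply ρ h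
    refine le_trans ?_ (hinv j i hji (h.trans_le hj))
    have h1 : ((ρ i : ℕ) : ℝ) < (i : ℕ) := by exact_mod_cast h
    have h2 : ((i : ℕ) : ℝ) ≤ (ρ j : ℕ) := by exact_mod_cast hj
    rw [abs_of_nonpos (by linarith), neg_sub]
    gcongr

theorem le_rpow_of_rootPow_le {β t X : ℝ} (hβ : 0 ≤ β) (ht0 : 0 ≤ t) (ht1 : t ≤ 1)
    (h : rootPow β t ≤ X) : t ≤ X ^ β := by
  rcases hβ.eq_or_lt with rfl | hβ'
  · simpa using ht1
  · rw [rootPow, if_neg hβ'.ne'] at h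
    have h2 := Real.rpow_le_rpow (Real.rpow_nonneg ht0 _) h hβ
    rwa [← Real.rpow_mul ht0, one_div_mul_cancel hβ'.ne', Real.rpow_one] at h2

theorem score_add [NeZero m] (S T : Tensor m d) (i : Fin d) :
    score (S + T) i = score S i + score T i := by
  simp only [score, Pi.add_apply, Finset.sum_add_distrib, add_div]

theorem score_permute [NeZero m] (T : Tensor m d) (π : Equiv.Perm (Fin d)) (i : Fin d) :
    score (permute T π) i = score T (π i) := by
  unfold score
  congr 1
  refine Finset.sum_nbij' (fun ω a => π (ω a)) (fun ω a => π.symm (ω a)) ?_ ?_ ?_ ?_ ?_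
  · intro ω hω
    simpa using hω
  · intro ω hω
    have := (Finset.mem_filter.1 hω).2
    simp [this]
  · intro ω _
    ext a
    simp
  · intro ω _
    ext a
    simp
  · intro ω _
    rfl

theorem frobSq_permute (T : Tensor m d) (π : Equiv.Perm (Fin d)) :
    frobSq (permute T π) = frobSq T :=
  Equiv.sum_comp (Equiv.arrowCongr (Equiv.refl (Fin m)) π) fun i => T i ^ 2

theorem frobSq_le {T : Tensor m d} {b : ℝ} (hT : ∀ i, T i ^ 2 ≤ b) :
    frobSq T ≤ (d : ℝ) ^ m * b := by
  refine (Finset.sum_le_card_nsmul _ _ _ fun i _ => hT i).trans (le_of_eq ?_)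
  rw [nsmul_eq_mul]
  simp

/-- The basic inequality of least squares: `T` is the signal, `E` the noise, `B` a competitor and
`S` a bound for the squared norm of the projected noise. -/
theorem frobSq_sub_le_of_least_squares {T E Θhat B : Tensor m d} {S : ℝ} (hS : 0 ≤ S)
    (hls : frobSq (T + E - Θhat) ≤ frobSq (T + E - B))
    (hE : (∑ i, (Θhat - B) i * E i) ^ 2 ≤ (∑ i, (Θhat - B) i ^ 2) * S) :
    frobSq (Θhat - T) ≤ 3 * frobSq (T - B) + 8 * S := by
  have h1 : frobSq (T + E - Θhat) =
      frobSq (T + E - B) + frobSq (Θhat - T) - frobSq (T - B) - 2 * ∑ i, (Θhat - B) i * E i := by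
    simp only [frobSq, Pi.sub_apply, Pi.add_apply, Finset.mul_sum, ← Finset.sum_add_distrib,
      ← Finset.sum_sub_distrib]
    exact Finset.sum_congr rfl fun i _ => by ring
  have h2 : ∑ i, (Θhat - B) i ^ 2 ≤ 2 * frobSq (Θhat - T) + 2 * frobSq (T - B) := by
    simp only [frobSq, Pi.sub_apply, Finset.mul_sum, ← Finset.sum_add_distrib]
    refine Finset.sum_le_sum fun i _ => ?_
    nlinarith [sq_nonneg ((Θhat i - T i) - (T i - B i))]
  set x := ∑ i, (Θhat - B) i * E i
  set q := ∑ i, (Θhat - B) i ^ 2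
  have hq : 0 ≤ q := Finset.sum_nonneg fun i _ => sq_nonneg _
  have h3 : |2 * x| ≤ q / 4 + 4 * S := by
    refine abs_le_of_sq_le_sq ?_ (by positivity)
    nlinarith [sq_nonneg (q / 4 - 4 * S)]
  have h4 := (abs_le.1 h3).2
  linarith

theorem norm_gridPoint_sub_le (i j : Fin m → Fin d) {Δ : ℝ} (hΔ : 0 ≤ Δ)
    (h : ∀ a, |((i a : ℕ) : ℝ) - ((j a : ℕ) : ℝ)| / d ≤ Δ) :
    ‖gridPoint i - gridPoint j‖ ≤ Δ := by
  refine (pi_norm_le_iff_of_nonneg hΔ).2 fun a => ?_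
  refine le_trans (le_of_eq ?_) (h a)
  rw [Pi.sub_apply, Real.norm_eq_abs, gridPoint, gridPoint, ← sub_div, abs_div, Nat.abs_cast]
  congr 2
  ring

/-- The deterministic part of the error bound. When the scores of the noise are at most `ε` and its
projections, over all orderings, have squared norm at most `S`, an inversion of `π ∘ πhat⁻¹` can
only involve indices whose true scores differ by at most `2 ε`, so that weak monotonicity bounds
its displacement. -/
theorem mse_le_of_noise_bounds [NeZero m] {β c₀ s K₁ ε δ S b : ℝ} (hβ : 0 ≤ β) (hc₀ : 0 < c₀)
    (hs : 0 ≤ s) (hK₁ : 0 ≤ K₁) (hS : 0 ≤ S) (hδ : 0 ≤ δ) (hε : 0 ≤ ε)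
    {f : (Fin m → ℝ) → ℝ}
    (hf : ∀ x ∈ Set.Icc (0 : Fin m → ℝ) 1, ∀ y ∈ Set.Icc (0 : Fin m → ℝ) 1,
      |f x - f y| ≤ K₁ * ‖x - y‖ ^ s)
    (hmono : ∀ i j : Fin d, j < i → c₀ * rootPow β ((((i : ℕ) : ℝ) - ((j : ℕ) : ℝ)) / (d : ℝ)) ≤
      score (signal d f) i - score (signal d f) j + δ)
    {k ℓ : ℕ} {B : Tensor m d} (hB : B ∈ blockPoly m d k ℓ)
    (hBf : ∀ i, |signal d f i - B i| ≤ b)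
    {N : ℕ} {u : Fin N → (Fin m → Fin d) → ℝ}
    (hu : ∀ v ∈ blockSubmodule m d k ℓ, ∀ e : (Fin m → Fin d) → ℝ,
      (∑ i, v i * e i) ^ 2 ≤ (∑ i, v i ^ 2) * ∑ k, (∑ i, u k i * e i) ^ 2)
    {π πhat : Equiv.Perm (Fin d)} {E Θhat : Tensor m d}
    (hscore : ∀ i, |score E i| ≤ ε)
    (hproj : ∀ ρ : Equiv.Perm (Fin d), ∑ k, (∑ i, u k i * E (fun a => ρ (i a))) ^ 2 ≤ S)
    (hest : IsBordaEstimate k ℓ (permute (signal d f) π + E) πhat Θhat) :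
    mse (permute Θhat πhat) (permute (signal d f) π) ≤
      6 * K₁ ^ 2 * (((2 * ε + δ) / c₀) ^ β) ^ (2 * s) + 6 * b ^ 2 + 8 * (S / (d : ℝ) ^ m) := by
  obtain ⟨hsort, hΘ, hls⟩ := hest
  set ρ : Equiv.Perm (Fin d) := πhat.symm.trans π
  set Δ : ℝ := ((2 * ε + δ) / c₀) ^ β with hΔ
  have hΔ0 : 0 ≤ Δ := Real.rpow_nonneg (by positivity) _
  have hdisp : ∀ i, |((ρ i : ℕ) : ℝ) - ((i : ℕ) : ℝ)| / d ≤ Δ := by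
    refine abs_apply_sub_div_le ρ hΔ0 fun i j hij hρ => ?_
    have hd : (0 : ℝ) < d := by exact_mod_cast i.pos
    have h1 := hsort i j hij.le
    rw [score_add, score_add, score_permute, score_permute] at h1
    have h2 := hmono (ρ i) (ρ j) hρ
    have h3 := abs_le.1 (hscore (πhat.symm i))
    have h4 := abs_le.1 (hscore (πhat.symm j))
    have h5 : score (signal d f) (ρ i) + score E (πhat.symm i) ≤
      score (signal d f) (ρ j) + score E (πhat.symm j) := h1
    have h6 : ((ρ j : ℕ) : ℝ) < (ρ i : ℕ) := by exact_mod_cast hρ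
    have h7 : ((ρ i : ℕ) : ℝ) ≤ d := by exact_mod_cast (ρ i).2.le
    have h8 : (0 : ℝ) ≤ (ρ j : ℕ) := Nat.cast_nonneg _
    refine le_rpow_of_rootPow_le hβ (div_nonneg (by linarith) hd.le)
      ((div_le_one hd).2 (by linarith)) ?_
    rw [le_div_iff₀ hc₀]
    linarith
  have hbias : frobSq (permute (signal d f) ρ - B) ≤
      (d : ℝ) ^ m * (2 * K₁ ^ 2 * Δ ^ (2 * s) + 2 * b ^ 2) := by
    refine frobSq_le fun i => ?_
    have h1 : |permute (signal d f) ρ i - signal d f i| ≤ K₁ * Δ ^ s := by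
      refine (hf _ (gridPoint_mem fun a => ρ (i a)) _ (gridPoint_mem i)).trans ?_
      have := norm_gridPoint_sub_le (fun a => ρ (i a)) i hΔ0 fun a => hdisp (i a)
      gcongr
    have h2 : Δ ^ (2 * s) = (Δ ^ s) ^ 2 := by
      rw [mul_comm, Real.rpow_mul hΔ0]
      norm_cast
    have h3 : (permute (signal d f) ρ i - signal d f i) ^ 2 ≤ (K₁ * Δ ^ s) ^ 2 :=
      sq_le_sq.2 (h1.trans (le_abs_self _))
    have h4 : (signal d f i - B i) ^ 2 ≤ b ^ 2 := sq_le_sq.2 ((hBf i).trans (le_abs_self _))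
    rw [h2, Pi.sub_apply]
    nlinarith [sq_nonneg ((permute (signal d f) ρ i - signal d f i) - (signal d f i - B i))]
  have hY : permute (permute (signal d f) π + E) πhat.symm =
      permute (signal d f) ρ + permute E πhat.symm := rfl
  have hls' := hls B hB
  rw [hY] at hls'
  have hmem : Θhat - B ∈ blockSubmodule m d k ℓ := (blockSubmodule m d k ℓ).sub_mem hΘ hB
  have hS' := hproj πhat.symm
  have hcs := (hu _ hmem (permute E πhat.symm)).trans
    (mul_le_mul_of_nonneg_left hS' (Finset.sum_nonneg fun i _ => sq_nonneg _))
  have hfin := frobSq_sub_le_of_least_squares hS hls' hcs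
  have hperm : permute Θhat πhat - permute (signal d f) π =
      permute (Θhat - permute (signal d f) ρ) πhat := by
    ext i
    simp [permute, ρ]
  rw [mse, hperm, frobSq_permute]
  rcases Nat.eq_zero_or_pos d with rfl | hd
  · have : ((0 : ℕ) : ℝ) ^ m = 0 := by simp [NeZero.ne m]
    rw [this, div_zero, div_zero, mul_zero, add_zero]
    positivity
  · have hd' : (0 : ℝ) < (d : ℝ) ^ m := by
      have : (0 : ℝ) < d := by exact_mod_cast hd
      positivity
    rw [div_le_iff₀ hd']
    have : 8 * (S / (d : ℝ) ^ m) * (d : ℝ) ^ m = 8 * S := by field_simp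
    nlinarith

theorem abs_score_signal_sub_le [NeZero m] {s K : ℝ} (hs : 0 ≤ s) (hK : 0 ≤ K)
    {f : (Fin m → ℝ) → ℝ}
    (hf : ∀ x ∈ Set.Icc (0 : Fin m → ℝ) 1, ∀ y ∈ Set.Icc (0 : Fin m → ℝ) 1,
      |f x - f y| ≤ K * ‖x - y‖ ^ s) (i j : Fin d) :
    |score (signal d f) i - score (signal d f) j| ≤
      K * (|((i : ℕ) : ℝ) - ((j : ℕ) : ℝ)| / d) ^ s := by
  classical
  have hd : (0 : ℝ) < d := by exact_mod_cast i.pos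
  have hre : ∑ ω : Fin m → Fin d with ω 0 = j, signal d f ω =
      ∑ ω : Fin m → Fin d with ω 0 = i, signal d f (Function.update ω 0 j) := by
    refine Finset.sum_nbij' (fun ω => Function.update ω 0 i) (fun ω => Function.update ω 0 j)
      ?_ ?_ ?_ ?_ ?_
    · intro ω _
      simp
    · intro ω _
      simp
    · intro ω hω
      have := (Finset.mem_filter.1 hω).2
      simp [← this]
    · intro ω hω
      have := (Finset.mem_filter.1 hω).2
      simp [← this]
    · intro ω hω
      have := (Finset.mem_filter.1 hω).2
      simp [← this]
  rw [score, score, hre, ← sub_div, ← Finset.sum_sub_distrib, abs_div,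
    abs_of_pos (by positivity : (0 : ℝ) < (d : ℝ) ^ (m - 1)), div_le_iff₀ (by positivity)]
  have hterm : ∀ ω ∈ Finset.univ.filter (fun ω : Fin m → Fin d => ω 0 = i),
      |signal d f ω - signal d f (Function.update ω 0 j)| ≤
        K * (|((i : ℕ) : ℝ) - ((j : ℕ) : ℝ)| / d) ^ s := by
    intro ω hω
    have hω0 := (Finset.mem_filter.1 hω).2
    refine (hf _ (gridPoint_mem ω) _ (gridPoint_mem _)).trans ?_
    have := norm_gridPoint_sub_le ω (Function.update ω 0 j)
      (Δ := |((i : ℕ) : ℝ) - ((j : ℕ) : ℝ)| / d) (by positivity) (fun a => by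
        by_cases ha : a = 0
        · subst ha
          rw [Function.update_self, hω0]
        · rw [Function.update_of_ne ha, sub_self, abs_zero, zero_div]
          positivity)
    gcongr
  refine (Finset.abs_sum_le_sum_abs _ _).trans ((Finset.sum_le_card_nsmul _ _ _ hterm).trans ?_)
  rw [card_filter_apply_zero_eq, nsmul_eq_mul, mul_comm]
  push_cast
  exact le_rfl

/-- When `β s > 1`, weak `β`-monotonicity and `s`-Hölder continuity contradict each other at a fixed
scale, up to a tolerance that tends to `0` with `d`, so they are compatible only for bounded `d`. -/
theorem exists_dim_bound [NeZero m] (hm : 2 ≤ m) {β s K c₀ D : ℝ} (hK : 0 ≤ K) (hs : 0 ≤ s)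
    (hc₀ : 0 < c₀) (hβ : 0 ≤ β) (hβs : 1 < β * s) :
    ∃ d₀ : ℝ, ∀ d : ℕ, 1 ≤ d → ∀ f : (Fin m → ℝ) → ℝ,
      (∀ x ∈ Set.Icc (0 : Fin m → ℝ) 1, ∀ y ∈ Set.Icc (0 : Fin m → ℝ) 1,
        |f x - f y| ≤ K * ‖x - y‖ ^ s) →
      IsWeaklyMonotone d β c₀ D f → (d : ℝ) ≤ d₀ := by
  have hβ0 : 0 < β := by
    rcases hβ.eq_or_lt with rfl | h
    · norm_num at hβs
    · exact h
  have hq : 1 / β < s := by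
    rw [div_lt_iff₀ hβ0]
    linarith
  have hqpos : 0 < 1 / β := by positivity
  -- below the scale `t₀`, smoothness contradicts monotonicity up to the tolerance
  obtain ⟨t₀, ht₀, ht₁, htK⟩ : ∃ t₀ : ℝ, 0 < t₀ ∧ t₀ < 1 ∧
      ∀ t, 0 < t → t ≤ t₀ → K * t ^ s ≤ c₀ / 2 * t ^ (1 / β) := by
    have hp : 0 < s - 1 / β := by linarith
    refine ⟨min (1 / 2) ((c₀ / (2 * (K + 1))) ^ (1 / (s - 1 / β))), by positivity,
      (min_le_left _ _).trans_lt (by norm_num), fun t ht htt => ?_⟩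
    have h1 : t ^ (s - 1 / β) ≤ c₀ / (2 * (K + 1)) := by
      have h2 := Real.rpow_le_rpow ht.le (htt.trans (min_le_right _ _)) hp.le
      rwa [← Real.rpow_mul (by positivity), one_div_mul_cancel hp.ne', Real.rpow_one] at h2
    have h3 : t ^ s = t ^ (s - 1 / β) * t ^ (1 / β) := by
      rw [← Real.rpow_add ht]
      congr 1
      ring
    rw [h3, ← mul_assoc]
    refine mul_le_mul_of_nonneg_right ?_ (by positivity)
    rw [le_div_iff₀ (by positivity)] at h1
    have h4 : 0 ≤ t ^ (s - 1 / β) := by positivity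
    nlinarith
  refine ⟨max (1 / t₀) ((2 * |D| / (c₀ * (t₀ / 2) ^ (1 / β))) ^ 2), fun d hd f hf hmono => ?_⟩
  by_contra! hlt
  have hd1 : 1 / t₀ < d := (le_max_left _ _).trans_lt hlt
  have hd2 := (le_max_right _ _).trans_lt hlt
  have hdpos : (0 : ℝ) < d := by exact_mod_cast hd
  obtain ⟨δ, hδ0, hδ, hmon⟩ := hmono
  rw [div_lt_iff₀ ht₀] at hd1
  set n := ⌊t₀ * d⌋₊
  have hn1 : 1 ≤ n := Nat.le_floor (by push_cast; linarith)
  have hnle : (n : ℝ) ≤ t₀ * d := Nat.floor_le (by positivity)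
  have hngt : t₀ * d < n + 1 := Nat.lt_floor_add_one _
  have hn1' : (1 : ℝ) ≤ n := by exact_mod_cast hn1
  have hnd : n < d := by
    have : (n : ℝ) < d := by nlinarith
    exact_mod_cast this
  have hpos : 0 < d := hd
  have h1 := hmon ⟨n, hnd⟩ ⟨0, hpos⟩ (by rw [Fin.lt_def]; exact hn1)
  have h2 := (le_abs_self _).trans (abs_score_signal_sub_le hs hK hf ⟨n, hnd⟩ ⟨0, hpos⟩)
  simp only [Nat.cast_zero, sub_zero, rootPow, if_neg hβ0.ne', Nat.abs_cast] at h1 h2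
  set t : ℝ := (n : ℝ) / d
  have ht : 0 < t := by positivity
  have htle : t ≤ t₀ := (div_le_iff₀ hdpos).2 hnle
  have htge : t₀ / 2 ≤ t := by
    rw [le_div_iff₀ hdpos]
    linarith
  have h3 := htK t ht htle
  have h4 : (t₀ / 2) ^ (1 / β) ≤ t ^ (1 / β) := by gcongr
  have h5 : δ ≤ |D| * (d : ℝ) ^ (-(1 : ℝ) / 2) := by
    refine hδ.trans ((mul_le_mul_of_nonneg_right (le_abs_self D) (by positivity)).trans ?_)
    refine mul_le_mul_of_nonneg_left ?_ (abs_nonneg D)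
    refine Real.rpow_le_rpow_of_exponent_le (by exact_mod_cast hd) ?_
    have : (2 : ℝ) ≤ m := by exact_mod_cast hm
    linarith
  have h6 : (d : ℝ) ^ (-(1 : ℝ) / 2) = 1 / √d := by
    rw [neg_div, Real.rpow_neg hdpos.le, Real.sqrt_eq_rpow]
    exact (one_div _).symm
  have h7 : c₀ * (t₀ / 2) ^ (1 / β) * √d ≤ 2 * |D| := by
    have h8 : c₀ / 2 * (t₀ / 2) ^ (1 / β) ≤ |D| * (1 / √d) := by
      rw [← h6]
      nlinarith
    have h9 : 0 < √(d : ℝ) := Real.sqrt_pos.2 hdpos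
    rw [mul_one_div, le_div_iff₀ h9] at h8
    linarith
  have h10 : √(d : ℝ) ≤ 2 * |D| / (c₀ * (t₀ / 2) ^ (1 / β)) := by
    rw [le_div_iff₀ (by positivity)]
    linarith
  have h11 : (d : ℝ) ≤ (2 * |D| / (c₀ * (t₀ / 2) ^ (1 / β))) ^ 2 := by
    rw [← Real.sq_sqrt hdpos.le]
    gcongr
  linarith

end

/-! ### The error bound -/

section

theorem log_div_pow_bounds {m d : ℕ} (hm : 2 ≤ m) (hd : 2 ≤ d) :
    Real.log 2 / (d : ℝ) ^ (m - 1) ≤ Real.log d / (d : ℝ) ^ (m - 1) ∧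
      Real.log d / (d : ℝ) ^ (m - 1) ≤ 1 := by
  have hd2 : (2 : ℝ) ≤ d := by exact_mod_cast hd
  have hdpos : (0 : ℝ) < d := by linarith
  constructor
  · gcongr
  · rw [div_le_one (by positivity)]
    calc Real.log d ≤ d := Real.log_le_self hdpos.le
      _ = (d : ℝ) ^ 1 := (pow_one _).symm
      _ ≤ (d : ℝ) ^ (m - 1) := pow_le_pow_right₀ (by linarith) (by omega)

/-- The permutation entropy `σ² log d / d^{m-1}` is dominated by its power `κ`: for `κ ≤ 1` since it
is bounded above, and for `κ > 1` since it is bounded below when `d` is bounded. -/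
theorem exists_le_const_mul_rpow {m : ℕ} (hm : 2 ≤ m) {σ : ℝ} (hσ : 0 < σ) (κ d₀ : ℝ) :
    ∃ C : ℝ, 0 ≤ C ∧ ∀ d : ℕ, 2 ≤ d → (1 < κ → (d : ℝ) ≤ d₀) →
      σ ^ 2 * (Real.log d / (d : ℝ) ^ (m - 1)) ≤
        C * (σ ^ 2 * (Real.log d / (d : ℝ) ^ (m - 1))) ^ κ := by
  set r₀ : ℝ := σ ^ 2 * (Real.log 2 / (max d₀ 1) ^ (m - 1))
  have hlog2 : 0 < Real.log 2 := Real.log_pos one_lt_two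
  have hr₀ : 0 < r₀ := by positivity
  refine ⟨(σ ^ 2) ^ (1 - κ) + r₀ ^ (1 - κ), by positivity, fun d hd hκ => ?_⟩
  obtain ⟨h1, h2⟩ := log_div_pow_bounds hm hd
  have hdpos : (0 : ℝ) < d := by
    have : (2 : ℝ) ≤ d := by exact_mod_cast hd
    linarith
  set q := Real.log d / (d : ℝ) ^ (m - 1)
  have hq : 0 < q := lt_of_lt_of_le (by positivity) h1
  have hr : 0 < σ ^ 2 * q := by positivity
  have hsplit : σ ^ 2 * q = (σ ^ 2 * q) ^ (1 - κ) * (σ ^ 2 * q) ^ κ := by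
    rw [← Real.rpow_add hr, sub_add_cancel, Real.rpow_one]
  have hbound : (σ ^ 2 * q) ^ (1 - κ) ≤ (σ ^ 2) ^ (1 - κ) + r₀ ^ (1 - κ) := by
    rcases le_or_gt κ 1 with hκ1 | hκ1
    · have h3 : σ ^ 2 * q ≤ σ ^ 2 := by nlinarith [sq_nonneg σ]
      have h4 : 0 ≤ 1 - κ := by linarith
      have h5 : (σ ^ 2 * q) ^ (1 - κ) ≤ (σ ^ 2) ^ (1 - κ) := by gcongr
      have h6 : 0 ≤ r₀ ^ (1 - κ) := by positivity
      linarith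
    · have hdd := (hκ hκ1).trans (le_max_left d₀ 1)
      have h3 : r₀ ≤ σ ^ 2 * q := by
        refine mul_le_mul_of_nonneg_left (le_trans ?_ h1) (sq_nonneg σ)
        gcongr
      have h5 := Real.rpow_le_rpow_of_nonpos hr₀ h3 (by linarith : 1 - κ ≤ 0)
      have h6 : 0 ≤ (σ ^ 2) ^ (1 - κ) := by positivity
      linarith
  calc σ ^ 2 * q = (σ ^ 2 * q) ^ (1 - κ) * (σ ^ 2 * q) ^ κ := hsplit
    _ ≤ _ := mul_le_mul_of_nonneg_right hbound (by positivity)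

/-- The tolerance in the comparison of two scores is of the order of the square root of
`σ² log d / d^{m-1}`, as `log d` is bounded below for `d ≥ 2`. -/
theorem score_tolerance_le {m d : ℕ} (hm : 2 ≤ m) (hd : 2 ≤ d) {σ c₀ D p r δ : ℝ} (hσ : 0 < σ)
    (hc₀ : 0 < c₀) (hp : 0 < p) (hr : r = σ ^ 2 * (Real.log d / (d : ℝ) ^ (m - 1)))
    (hδ : δ ≤ D * (d : ℝ) ^ (-((m : ℝ) - 1) / 2)) :
    (2 * √(2 * (p + 3) * r) + δ) / c₀ ≤
      (2 * √(2 * (p + 3)) + |D| / (σ * √(Real.log 2))) / c₀ * √r := by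
  have hd2 : (2 : ℝ) ≤ d := by exact_mod_cast hd
  have hdpos : (0 : ℝ) < d := by linarith
  have hlogd : 0 < Real.log d := Real.log_pos (by linarith)
  have hlog2 : 0 < Real.log 2 := Real.log_pos one_lt_two
  have h2 : δ ≤ |D| / (σ * √(Real.log 2)) * √r := by
    have hpow : (d : ℝ) ^ (-((m : ℝ) - 1) / 2) = 1 / √((d : ℝ) ^ (m - 1)) := by
      rw [Real.sqrt_eq_rpow, ← Real.rpow_natCast, ← Real.rpow_mul hdpos.le, neg_div,
        Real.rpow_neg hdpos.le, one_div, Nat.cast_sub (by omega)]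
      congr 2
      push_cast
      ring
    have hsq : √r = σ * (√(Real.log d) / √((d : ℝ) ^ (m - 1))) := by
      rw [hr, Real.sqrt_mul (sq_nonneg σ), Real.sqrt_sq hσ.le, Real.sqrt_div hlogd.le]
    have hl2 : 0 < √(Real.log 2) := Real.sqrt_pos.2 hlog2
    have hl : √(Real.log 2) ≤ √(Real.log d) :=
      Real.sqrt_le_sqrt (Real.log_le_log two_pos hd2)
    have hw : 0 < √((d : ℝ) ^ (m - 1)) := Real.sqrt_pos.2 (by positivity)
    refine hδ.trans ?_
    rw [hpow, hsq]
    calc D * (1 / √((d : ℝ) ^ (m - 1))) ≤ |D| * (1 / √((d : ℝ) ^ (m - 1))) := by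
          gcongr
          exact le_abs_self D
      _ = |D| / (σ * √(Real.log 2)) * (σ * (√(Real.log 2) / √((d : ℝ) ^ (m - 1)))) := by
          field_simp
      _ ≤ _ := by gcongr
  rw [Real.sqrt_mul (by positivity), div_mul_eq_mul_div]
  gcongr
  linarith

theorem natCast_dim_le {m k ℓ N : ℕ} (hN : N ≤ k ^ m * (m + 1) ^ ℓ) :
    (N : ℝ) ≤ (k : ℝ) ^ m * ((ℓ : ℝ) + (m : ℝ)) ^ ℓ := by
  have h1 : (N : ℝ) ≤ (k : ℝ) ^ m * ((m : ℝ) + 1) ^ ℓ := by exact_mod_cast hN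
  refine h1.trans (mul_le_mul_of_nonneg_left ?_ (by positivity))
  rcases Nat.eq_zero_or_pos ℓ with rfl | hℓ
  · simp
  · have : (1 : ℝ) ≤ ℓ := by exact_mod_cast hℓ
    exact pow_le_pow_left₀ (by positivity) (by linarith) _

theorem noise_term_le {m d : ℕ} (hm : 2 ≤ m) (hd : 2 ≤ d) {σ p n n' : ℝ} (hp : 0 < p)
    (hn : 0 ≤ n) (hnn : n ≤ n') :
    8 * (4 * σ ^ 2 * (d * Real.log d + n / 2 + (p + 1) * Real.log d) / (d : ℝ) ^ m) ≤
      32 * (p + 2) * (σ ^ 2 * (Real.log d / (d : ℝ) ^ (m - 1))) +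
        32 * (σ ^ 2 * (n' / (d : ℝ) ^ m)) := by
  have hd2 : (2 : ℝ) ≤ d := by exact_mod_cast hd
  have hdpos : (0 : ℝ) < d := by linarith
  have hlogd : 0 < Real.log d := Real.log_pos (by linarith)
  have h1 : d * Real.log d + n / 2 + (p + 1) * Real.log d ≤ (p + 2) * (d * Real.log d) + n' := by
    have h2 : (p + 1) * Real.log d ≤ (p + 1) * (d * Real.log d) := by
      gcongr
      exact le_mul_of_one_le_left hlogd.le (by linarith)
    linarith
  have h3 : Real.log d / (d : ℝ) ^ (m - 1) = d * Real.log d / (d : ℝ) ^ m := by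
    have : (d : ℝ) ^ m = d * (d : ℝ) ^ (m - 1) := by
      rw [← pow_succ', Nat.sub_add_cancel (by omega)]
    rw [this, mul_div_mul_left _ _ hdpos.ne']
  rw [h3]
  calc 8 * (4 * σ ^ 2 * (d * Real.log d + n / 2 + (p + 1) * Real.log d) / (d : ℝ) ^ m)
      ≤ 8 * (4 * σ ^ 2 * ((p + 2) * (d * Real.log d) + n') / (d : ℝ) ^ m) := by gcongr
    _ = _ := by ring

/-- The failure probabilities of the two noise events add up to at most `d ^ (-p)`. -/
theorem tail_sum_le {d : ℕ} (hd : 2 ≤ d) (p : ℝ) :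
    Real.exp (-((p + 1) * Real.log d)) + 2 * d * Real.exp (-((p + 3) * Real.log d)) ≤
      (d : ℝ) ^ (-p) := by
  have hd2 : (2 : ℝ) ≤ d := by exact_mod_cast hd
  have hdpos : (0 : ℝ) < d := by linarith
  have hy : ∀ n : ℕ, Real.exp (-((p + n) * Real.log d)) = (d : ℝ) ^ (-p) / (d : ℝ) ^ n := by
    intro n
    rw [Real.rpow_def_of_pos hdpos, ← Real.exp_log (pow_pos hdpos n), Real.log_pow, ← Real.exp_sub]
    congr 1
    ring
  have hy1 := hy 1
  have hy3 := hy 3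
  push_cast at hy1 hy3
  rw [hy1, hy3]
  have hy0 : 0 < (d : ℝ) ^ (-p) := by positivity
  have h3 : (d : ℝ) ^ (-p) / (d : ℝ) ^ 1 + 2 * d * ((d : ℝ) ^ (-p) / (d : ℝ) ^ 3) =
      (d : ℝ) ^ (-p) * ((d + 2) / d ^ 2) := by
    field_simp
  rw [h3]
  refine mul_le_of_le_one_right hy0.le ?_
  rw [div_le_one (by positivity)]
  nlinarith

theorem linear_comb_le {A₁ A₂ A₃ x v y a b c : ℝ} (h₁ : 0 ≤ A₁) (h₂ : 0 ≤ A₂) (h₃ : 0 ≤ A₃)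
    (hx : 0 ≤ x) (hv : 0 ≤ v) (hy : 0 ≤ y) (ha : a ≤ A₂ * y) (hb : b = A₁ * x)
    (hc : c ≤ A₃ * y + 32 * v) :
    a + b + c ≤ (A₁ + A₂ + A₃ + 32) * (x + v + y) := by
  have b1 := mul_nonneg h₁ hv
  have b2 := mul_nonneg h₁ hy
  have b3 := mul_nonneg h₂ hx
  have b4 := mul_nonneg h₂ hv
  have b5 := mul_nonneg h₃ hx
  have b6 := mul_nonneg h₃ hv
  linarith

/-- The error bound for all block numbers and degrees. Projected noise of squared norm of order
`σ² (N + d log d)` and score noise of order `√(σ² log d / d^{m-1})` are exceeded with probability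
at most `d ^ (-p)`. -/
theorem exists_failureProb_le (m : ℕ) [NeZero m] (hm : 2 ≤ m)
    (α β L σ : ℝ) (hα : 0 ≤ α) (hβ : 0 ≤ β) (hL : 0 < L) (hσ : 0 < σ)
    (c₀ D M : ℝ) (hc₀ : 0 < c₀) (p : ℝ) (hp : 0 < p) :
    ∃ C : ℝ, 0 < C ∧
      ∀ (d : ℕ), 2 ≤ d →
      ∀ f : (Fin m → ℝ) → ℝ, IsHolderSmooth α L f → IsWeaklyMonotone d β c₀ D f →
        (∀ x ∈ Set.Icc (0 : Fin m → ℝ) 1, ∀ y ∈ Set.Icc (0 : Fin m → ℝ) 1, |f x - f y| ≤ M) →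
      ∀ (π : Equiv.Perm (Fin d)) (Ω : Type*) [MeasurableSpace Ω] (μ : Measure Ω)
        [IsProbabilityMeasure μ] (ξ : (Fin m → Fin d) → Ω → ℝ), iIndepFun ξ μ →
        (∀ i, HasSubgaussianMGF (ξ i) (σ ^ 2).toNNReal μ) →
      ∀ k ℓ : ℕ, 1 ≤ k →
        failureProb μ k ℓ (signal d f) π ξ (C * errorBound m d k ℓ α β L σ)
          ≤ ENNReal.ofReal ((d : ℝ) ^ (-p)) := by
  obtain ⟨K₁, hK₁, hholder⟩ := exists_holder_bound (m := m) α L M hα hL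
  obtain ⟨K₂, hK₂, happrox⟩ := exists_blockPoly_approx (m := m) α L M hα hL
  set s : ℝ := min α 1 with hsdef
  have hs : 0 ≤ s := le_min hα zero_le_one
  have hκ : 0 ≤ β * s := mul_nonneg hβ hs
  obtain ⟨d₀, hd₀⟩ : ∃ d₀ : ℝ, 1 < β * s → ∀ d : ℕ, 1 ≤ d → ∀ f : (Fin m → ℝ) → ℝ,
      (∀ x ∈ Set.Icc (0 : Fin m → ℝ) 1, ∀ y ∈ Set.Icc (0 : Fin m → ℝ) 1,
        |f x - f y| ≤ K₁ * ‖x - y‖ ^ s) →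
      IsWeaklyMonotone d β c₀ D f → (d : ℝ) ≤ d₀ := by
    by_cases h : 1 < β * s
    · obtain ⟨d₀, hd₀⟩ := exists_dim_bound (D := D) hm hK₁ hs hc₀ hβ h
      exact ⟨d₀, fun _ => hd₀⟩
    · exact ⟨0, fun h' => absurd h' h⟩
  obtain ⟨C₁, hC₁, hr⟩ := exists_le_const_mul_rpow hm hσ (β * s) d₀
  have hlog2 : 0 < Real.log 2 := Real.log_pos one_lt_two
  set Q : ℝ := (2 * √(2 * (p + 3)) + |D| / (σ * √(Real.log 2))) / c₀
  have hQ : 0 ≤ Q := by positivity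
  refine ⟨6 * K₂ ^ 2 / L ^ 2 + 6 * K₁ ^ 2 * Q ^ (β * (2 * s)) + 32 * (p + 2) * C₁ + 32,
    by positivity, ?_⟩
  intro d hd f hf hmono hM π Ω _ μ _ ξ hind hsub k ℓ hk
  have hd2 : (2 : ℝ) ≤ d := by exact_mod_cast hd
  have hdpos : (0 : ℝ) < d := by linarith
  have hlogd : 0 < Real.log d := Real.log_pos (by linarith)
  have hfK := hholder f hf hM
  have hrd := hr d hd fun h => hd₀ h d (by omega) f hfK hmono
  obtain ⟨δ, hδ0, hδ, hmon⟩ := hmono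
  obtain ⟨B, hB, hBf⟩ := happrox f hf hM d k ℓ hk
  set v : ℝ≥0 := (σ ^ 2).toNNReal with hvdef
  have hv : (v : ℝ) = σ ^ 2 := Real.coe_toNNReal _ (sq_nonneg σ)
  have hvpos : 0 < v := by
    rw [hvdef, Real.toNNReal_pos]
    positivity
  have hN := finrank_blockSubmodule_le (m := m) (d := d) hk ℓ
  have hfamily := exists_orthonormal_family (blockSubmodule m d k ℓ)
  generalize Module.finrank ℝ (blockSubmodule m d k ℓ) = N at hN hfamily
  obtain ⟨u, hu, hproj⟩ := hfamily
  set r : ℝ := σ ^ 2 * (Real.log d / (d : ℝ) ^ (m - 1)) with hrdef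
  have hrpos : 0 < r := by positivity
  -- the score noise has variance proxy `σ² / d^{m-1}`, and `d` scores are compared with two-sided
  -- bounds: the exponent `p + 3` leaves `2 d ^ (-(p + 2))`
  set ε : ℝ := √(2 * (p + 3) * r) with hεdef
  have hε2 : ε ^ 2 = 2 * (p + 3) * r := Real.sq_sqrt (by positivity)
  have hε0 : 0 ≤ ε := Real.sqrt_nonneg _
  -- `d log d` pays for the permutations and `N / 2` for the dimension
  set t : ℝ := d * Real.log d + N / 2 + (p + 1) * Real.log d with htdef
  have ht0 : 0 ≤ t := by positivity
  have hb1 := measure_exists_perm_gt_le hind hvpos hsub u hu (by omega) t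
  have hb2 := measure_exists_score_gt_le hind hsub (by omega) hε0
  have hsubset : {ω | ∃ (πhat : Equiv.Perm (Fin d)) (Θhat : Tensor m d),
      IsBordaEstimate k ℓ (permute (signal d f) π + fun i => ξ i ω) πhat Θhat ∧
      (6 * K₂ ^ 2 / L ^ 2 + 6 * K₁ ^ 2 * Q ^ (β * (2 * s)) + 32 * (p + 2) * C₁ + 32) *
        errorBound m d k ℓ α β L σ < mse (permute Θhat πhat) (permute (signal d f) π)} ⊆
      {ω | ∃ ρ : Equiv.Perm (Fin d),
        4 * v * t < ∑ k, (∑ i, u k i * ξ (fun a => ρ (i a)) ω) ^ 2} ∪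
      {ω | ∃ i : Fin d, ε < |score (fun j => ξ j ω) i|} := by
    rintro ω ⟨πhat, Θhat, hest, hlt⟩
    by_contra hω
    rw [Set.mem_union, not_or] at hω
    have hω1 : ∀ ρ : Equiv.Perm (Fin d),
        ∑ k, (∑ i, u k i * ξ (fun a => ρ (i a)) ω) ^ 2 ≤ 4 * v * t :=
      fun ρ => not_lt.1 fun h => hω.1 ⟨ρ, h⟩
    have hω2 : ∀ i : Fin d, |score (fun j => ξ j ω) i| ≤ ε :=
      fun i => not_lt.1 fun h => hω.2 ⟨i, h⟩
    refine absurd hlt (not_lt.2 ?_)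
    refine (mse_le_of_noise_bounds hβ hc₀ hs hK₁ (by positivity) hδ0 hε0 hfK hmon hB hBf hproj
      hω2 hω1 hest).trans ?_
    have hbias : 6 * (K₂ * (1 / (k : ℝ)) ^ min α ((ℓ : ℝ) + 1)) ^ 2 =
        6 * K₂ ^ 2 / L ^ 2 * (L ^ 2 / (k : ℝ) ^ (2 * min α ((ℓ : ℝ) + 1))) := by
      have hk' : (0 : ℝ) < k := by exact_mod_cast hk
      have h1 : (k : ℝ) ^ (2 * min α ((ℓ : ℝ) + 1)) = ((k : ℝ) ^ min α ((ℓ : ℝ) + 1)) ^ 2 := by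
        rw [mul_comm, Real.rpow_mul hk'.le]
        norm_cast
      rw [h1, one_div, Real.inv_rpow hk'.le]
      have : (k : ℝ) ^ min α ((ℓ : ℝ) + 1) ≠ 0 := (Real.rpow_pos_of_pos hk' _).ne'
      field_simp
    have hX : (2 * ε + δ) / c₀ ≤ Q * √r := score_tolerance_le hm hd hσ hc₀ hp rfl hδ
    have hperm : (((2 * ε + δ) / c₀) ^ β) ^ (2 * s) ≤ Q ^ (β * (2 * s)) * r ^ (β * s) := by
      have h0 : 0 ≤ (2 * ε + δ) / c₀ := by positivity
      rw [← Real.rpow_mul h0]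
      have h1 : r ^ (β * s) = (√r) ^ (β * (2 * s)) := by
        rw [Real.sqrt_eq_rpow, ← Real.rpow_mul hrpos.le]
        congr 1
        ring
      rw [h1, ← Real.mul_rpow hQ (Real.sqrt_nonneg _)]
      gcongr
    have hnoise := noise_term_le (σ := σ) hm hd hp (Nat.cast_nonneg N) (natCast_dim_le hN)
    refine linear_comb_le (by positivity) (by positivity) (by positivity) (by positivity)
      (by positivity) (by positivity) ?_ hbias ?_
    · rw [mul_assoc (6 * K₁ ^ 2)]
      gcongr
    · rw [hv]
      refine hnoise.trans ?_
      rw [mul_assoc (32 * (p + 2)) C₁]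
      gcongr
  refine (measure_mono hsubset).trans ((measure_union_le _ _).trans ((add_le_add hb1 hb2).trans ?_))
  rw [← ENNReal.ofReal_add (by positivity) (by positivity)]
  refine ENNReal.ofReal_le_ofReal ?_
  have h1 : d * Real.log d + N / 2 - t = -((p + 1) * Real.log d) := by
    rw [htdef]
    ring
  have h2 : ε ^ 2 * (d : ℝ) ^ (m - 1) / (2 * v) = (p + 3) * Real.log d := by
    rw [hε2, hv, hrdef]
    field_simp
  rw [h1, h2]
  exact tail_sum_le hd p

end

/-! ### Rates for the tuned block number and degree -/

section

theorem threshold_eq (m : ℕ) (α β : ℝ) :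
    threshold m α β = ENNReal.ofReal (m * (((m : ℝ) - 1) * (β * min α 1))) /
      ENNReal.ofReal (2 * (m - ((m : ℝ) - 1) * (β * min α 1))) := by
  rw [threshold]
  congr 2 <;> ring

theorem threshold_eq_top {m : ℕ} (hm : 2 ≤ m) {α β : ℝ}
    (h : (m : ℝ) ≤ ((m : ℝ) - 1) * (β * min α 1)) : threshold m α β = ⊤ := by
  have hm' : (2 : ℝ) ≤ m := by exact_mod_cast hm
  rw [threshold_eq, ENNReal.ofReal_of_nonpos (p := 2 * _) (by linarith), ENNReal.div_zero]
  simp only [ne_eq, ENNReal.ofReal_eq_zero, not_le]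
  nlinarith

/-- In the smoothness-limited regime `α < c(α, β, m)`, the degree is `⌊α⌋`, and the rate
`2 m α / (m + 2 α)` is smaller than the permutation rate `(m - 1) β min(α, 1)`. -/
theorem optDegree_of_lt_threshold {m : ℕ} (hm : 2 ≤ m) {α β : ℝ} (hα : 0 ≤ α)
    (h : ENNReal.ofReal α < threshold m α β) :
    optDegree m α β = ⌊α⌋₊ ∧
      2 * α * m < ((m : ℝ) - 1) * (β * min α 1) * (m + 2 * α) := by
  have hm' : (2 : ℝ) ≤ m := by exact_mod_cast hm
  set w : ℝ := ((m : ℝ) - 1) * (β * min α 1) with hw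
  have hthr : threshold m α β = ENNReal.ofReal (m * w) / ENNReal.ofReal (2 * (m - w)) :=
    threshold_eq m α β
  rcases le_or_gt ((m : ℝ) - w) 0 with hy | hy
  · have htop : threshold m α β = ⊤ := threshold_eq_top hm (by linarith)
    exact ⟨by rw [optDegree, if_pos htop], by nlinarith⟩
  · rw [← ENNReal.ofReal_div_of_pos (by linarith)] at hthr
    rw [hthr] at h
    have h1 : α < m * w / (2 * (m - w)) := (ENNReal.ofReal_lt_ofReal_iff_of_nonneg hα).1 h
    constructor
    · rw [optDegree, hthr, if_neg ENNReal.ofReal_ne_top, ENNReal.toReal_ofReal (by linarith)]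
      exact min_eq_left (Nat.floor_mono h1.le)
    · rw [lt_div_iff₀ (by linarith)] at h1
      nlinarith

/-- In the permutation-limited regime `c(α, β, m) ≤ α`, the rate of the block approximation with the
tuned degree is at least the permutation rate `(m - 1) β min(α, 1)`. -/
theorem le_of_threshold_le {m : ℕ} (hm : 2 ≤ m) {α β : ℝ} (hα : 0 ≤ α) (hβ : 0 ≤ β)
    (h : threshold m α β ≤ ENNReal.ofReal α) :
    ((m : ℝ) - 1) * (β * min α 1) * (m + 2 * min α ((optDegree m α β : ℝ) + 1)) ≤
      2 * min α ((optDegree m α β : ℝ) + 1) * m := by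
  have hm' : (2 : ℝ) ≤ m := by exact_mod_cast hm
  set w : ℝ := ((m : ℝ) - 1) * (β * min α 1) with hw
  have hw0 : 0 ≤ w := mul_nonneg (by linarith) (mul_nonneg hβ (le_min hα zero_le_one))
  have hthr : threshold m α β = ENNReal.ofReal (m * w) / ENNReal.ofReal (2 * (m - w)) :=
    threshold_eq m α β
  have hy : 0 < (m : ℝ) - w := by
    by_contra! hy
    have htop : threshold m α β = ⊤ := threshold_eq_top hm (by linarith)
    rw [htop] at h
    exact ENNReal.ofReal_ne_top (top_le_iff.1 h)
  rw [← ENNReal.ofReal_div_of_pos (by linarith)] at hthr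
  rw [hthr] at h
  have h1 : m * w / (2 * (m - w)) ≤ α := (ENNReal.ofReal_le_ofReal_iff hα).1 h
  have hc0 : 0 ≤ m * w / (2 * (m - w)) := by positivity
  have hdeg : optDegree m α β = ⌊m * w / (2 * (m - w))⌋₊ := by
    rw [optDegree, hthr, if_neg ENNReal.ofReal_ne_top, ENNReal.toReal_ofReal hc0]
    exact min_eq_right (Nat.floor_mono h1)
  have h2 : m * w / (2 * (m - w)) ≤ min α ((optDegree m α β : ℝ) + 1) := by
    refine le_min h1 ?_
    rw [hdeg]
    exact (Nat.lt_floor_add_one _).le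
  rw [div_le_iff₀ (by linarith)] at h2
  linarith

/-- With the tuned block number, the approximation error and the variance are of the same order in
`d`. -/
theorem exists_errorBound_optBlocks_le {m : ℕ} (hm : 2 ≤ m) {α β L σ c₁ : ℝ} (hα : 0 ≤ α)
    (hc₁ : 0 < c₁) :
    ∃ C : ℝ, 0 ≤ C ∧ ∀ d : ℕ, 1 ≤ d →
      errorBound m d (optBlocks m d α β c₁) (optDegree m α β) α β L σ ≤
        C * (d : ℝ) ^ (-(2 * (m : ℝ) * min α ((optDegree m α β : ℝ) + 1)) /
            ((m : ℝ) + 2 * min α ((optDegree m α β : ℝ) + 1))) +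
          (σ ^ 2) ^ (β * min α 1) * (Real.log d / (d : ℝ) ^ (m - 1)) ^ (β * min α 1) := by
  have hm' : (2 : ℝ) ≤ m := by exact_mod_cast hm
  set ℓ := optDegree m α β
  set a : ℝ := min α ((ℓ : ℝ) + 1) with ha
  have ha0 : 0 ≤ a := le_min hα (by positivity)
  have hden : 0 < (m : ℝ) + 2 * a := by linarith
  refine ⟨L ^ 2 / (min 1 c₁) ^ (2 * a) + σ ^ 2 * (c₁ + 1) ^ m * ((ℓ : ℝ) + m) ^ ℓ,
    by positivity, fun d hd => ?_⟩
  have hd1 : (1 : ℝ) ≤ d := by exact_mod_cast hd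
  have hdpos : (0 : ℝ) < d := by linarith
  set E : ℝ := (m : ℝ) / ((m : ℝ) + 2 * a) with hE
  have hE0 : 0 ≤ E := by positivity
  have hE1 : E ≤ 1 := (div_le_one hden).2 (by linarith)
  set x : ℝ := (d : ℝ) ^ E with hx
  have hx1 : 1 ≤ x := Real.one_le_rpow hd1 hE0
  have hxd : x ≤ d := by
    calc x ≤ (d : ℝ) ^ (1 : ℝ) := Real.rpow_le_rpow_of_exponent_le hd1 hE1
      _ = d := Real.rpow_one _
  set k := optBlocks m d α β c₁ with hk
  have hkdef : k = min d ⌈c₁ * x⌉₊ := rfl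
  have hklow : min 1 c₁ * x ≤ k := by
    rw [hkdef, Nat.cast_min]
    refine le_min ?_ ?_
    · exact (mul_le_of_le_one_left (by linarith) (min_le_left _ _)).trans hxd
    · exact (mul_le_mul_of_nonneg_right (min_le_right _ _) (by linarith)).trans (Nat.le_ceil _)
  have hkupp : (k : ℝ) ≤ (c₁ + 1) * x := by
    have h1 : (k : ℝ) ≤ ⌈c₁ * x⌉₊ := by exact_mod_cast min_le_right _ _
    have h2 := Nat.ceil_lt_add_one (a := c₁ * x) (by positivity)
    linarith
  have hmin : 0 < min 1 c₁ := lt_min one_pos hc₁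
  set e : ℝ := -(2 * (m : ℝ) * a) / ((m : ℝ) + 2 * a) with he
  have hbias : L ^ 2 / (k : ℝ) ^ (2 * a) ≤ L ^ 2 / (min 1 c₁) ^ (2 * a) * (d : ℝ) ^ e := by
    have h1 : (d : ℝ) ^ e = (x ^ (2 * a))⁻¹ := by
      rw [hx, ← Real.rpow_mul hdpos.le, ← Real.rpow_neg hdpos.le]
      congr 1
      rw [he, hE]
      field_simp
    rw [h1, ← div_eq_mul_inv, div_div, ← Real.mul_rpow hmin.le (by linarith)]
    gcongr
  have hvar : σ ^ 2 * ((k : ℝ) ^ m * ((ℓ : ℝ) + (m : ℝ)) ^ ℓ / (d : ℝ) ^ m) ≤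
      σ ^ 2 * (c₁ + 1) ^ m * ((ℓ : ℝ) + m) ^ ℓ * (d : ℝ) ^ e := by
    have h1 : (d : ℝ) ^ e = x ^ m / (d : ℝ) ^ m := by
      rw [hx, ← Real.rpow_natCast, ← Real.rpow_natCast, ← Real.rpow_mul hdpos.le,
        ← Real.rpow_sub hdpos]
      congr 1
      rw [he, hE]
      field_simp
      ring
    rw [h1]
    calc σ ^ 2 * ((k : ℝ) ^ m * ((ℓ : ℝ) + (m : ℝ)) ^ ℓ / (d : ℝ) ^ m)
        ≤ σ ^ 2 * (((c₁ + 1) * x) ^ m * ((ℓ : ℝ) + (m : ℝ)) ^ ℓ / (d : ℝ) ^ m) := by gcongr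
      _ = _ := by
        rw [mul_pow]
        ring
  have hlog : 0 ≤ Real.log d / (d : ℝ) ^ (m - 1) := div_nonneg (Real.log_nonneg hd1) (by positivity)
  rw [errorBound, Real.mul_rpow (sq_nonneg σ) hlog, add_mul]
  gcongr

/-- A rate strictly smaller than the permutation rate absorbs the logarithm. -/
theorem exists_log_rate_le {m : ℕ} (hm : 2 ≤ m) {κ e : ℝ} (he : 0 ≤ e)
    (heκ : e < ((m : ℝ) - 1) * κ) :
    ∃ C : ℝ, 0 ≤ C ∧ ∀ d : ℕ, 1 ≤ d →
      (Real.log d / (d : ℝ) ^ (m - 1)) ^ κ ≤ C * (d : ℝ) ^ (-e) := by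
  have hm' : (2 : ℝ) ≤ m := by exact_mod_cast hm
  have hκ : 0 < κ := by
    by_contra! h
    nlinarith
  set η : ℝ := ((m : ℝ) - 1) - e / κ with hη
  have hη0 : 0 < η := by
    rw [hη, sub_pos, div_lt_iff₀ hκ]
    exact heκ
  refine ⟨(1 / η) ^ κ, by positivity, fun d hd => ?_⟩
  have hd1 : (1 : ℝ) ≤ d := by exact_mod_cast hd
  have hdpos : (0 : ℝ) < d := by linarith
  have h1 : Real.log d / (d : ℝ) ^ (m - 1) ≤ 1 / η * (d : ℝ) ^ (-(e / κ)) := by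
    have h2 : (d : ℝ) ^ (-(e / κ)) = (d : ℝ) ^ η / (d : ℝ) ^ (m - 1) := by
      rw [← Real.rpow_natCast, ← Real.rpow_sub hdpos, Nat.cast_sub (by omega)]
      congr 1
      rw [hη]
      push_cast
      ring
    rw [h2, ← mul_div_assoc]
    gcongr
    rw [one_div, inv_mul_eq_div]
    exact Real.log_le_rpow_div hdpos.le hη0
  have h0 : 0 ≤ Real.log d / (d : ℝ) ^ (m - 1) := div_nonneg (Real.log_nonneg hd1) (by positivity)
  refine (Real.rpow_le_rpow h0 h1 hκ.le).trans (le_of_eq ?_)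
  rw [Real.mul_rpow (by positivity) (by positivity), ← Real.rpow_mul hdpos.le]
  congr 2
  field_simp

theorem rate_le_log_rate {m d : ℕ} (hm : 2 ≤ m) (hd : 2 ≤ d) {κ e : ℝ} (hκ : 0 ≤ κ)
    (heκ : ((m : ℝ) - 1) * κ ≤ e) :
    (d : ℝ) ^ (-e) ≤ (1 / Real.log 2) ^ κ * (Real.log d / (d : ℝ) ^ (m - 1)) ^ κ := by
  have hd2 : (2 : ℝ) ≤ d := by exact_mod_cast hd
  have hdpos : (0 : ℝ) < d := by linarith
  have hlog2 : 0 < Real.log 2 := Real.log_pos one_lt_two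
  have hlogd : 0 < Real.log d := Real.log_pos (by linarith)
  rw [← Real.mul_rpow (by positivity) (by positivity)]
  calc (d : ℝ) ^ (-e) ≤ (d : ℝ) ^ (-(((m : ℝ) - 1) * κ)) :=
        Real.rpow_le_rpow_of_exponent_le (by linarith) (by linarith)
    _ = (1 / (d : ℝ) ^ (m - 1)) ^ κ := by
        rw [← neg_mul, Real.rpow_mul hdpos.le, Real.rpow_neg hdpos.le, ← Real.rpow_natCast,
          Nat.cast_sub (by omega), one_div]
        norm_num
    _ = (1 / Real.log 2 * (Real.log 2 / (d : ℝ) ^ (m - 1))) ^ κ := by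
        congr 1
        field_simp
    _ ≤ _ := by
        have := (log_div_pow_bounds hm hd).1
        gcongr

theorem failureProb_anti {m d : ℕ} [NeZero m] {Ω : Type*} [MeasurableSpace Ω] (μ : Measure Ω)
    (k ℓ : ℕ) (Θ : Tensor m d) (π : Equiv.Perm (Fin d)) (ξ : (Fin m → Fin d) → Ω → ℝ) {r r' : ℝ}
    (h : r ≤ r') : failureProb μ k ℓ Θ π ξ r' ≤ failureProb μ k ℓ Θ π ξ r := by
  refine measure_mono ?_
  rintro ω ⟨πhat, Θhat, h1, h2⟩
  exact ⟨πhat, Θhat, h1, h.trans_lt h2⟩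

theorem one_le_optBlocks {m d : ℕ} {α β c₁ : ℝ} (hc₁ : 0 < c₁) (hd : 1 ≤ d) :
    1 ≤ optBlocks m d α β c₁ := by
  have hdpos : (0 : ℝ) < d := by exact_mod_cast hd
  exact le_min hd (Nat.ceil_pos.2 (by positivity))

theorem errorBound_nonneg {m d k ℓ : ℕ} {α β L σ : ℝ} (hd : 1 ≤ d) :
    0 ≤ errorBound m d k ℓ α β L σ := by
  have : 0 ≤ Real.log d := Real.log_natCast_nonneg d
  unfold errorBound
  positivity

end

end Borda

end

theorem theorem3 (m : ℕ) [NeZero m] (hm : 2 ≤ m)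
    -- smoothness, monotonicity, Hölder constant, noise level
    (α β L σ : ℝ) (hα : 0 ≤ α) (hβ : 0 ≤ β) (hL : 0 < L) (hσ : 0 < σ)
    -- constants in the weak monotonicity, bound for the oscillation of the function
    (c₀ D M : ℝ) (hc₀ : 0 < c₀)
    -- constant in the block number, exponent in the failure probability
    (c₁ p : ℝ) (hc₁ : 0 < c₁) (hp : 0 < p) :
    ∃ C : ℝ, 0 < C ∧
      ∀ (d : ℕ), 1 ≤ d →
      ∀ f : (Fin m → ℝ) → ℝ, Borda.IsHolderSmooth α L f → Borda.IsWeaklyMonotone d β c₀ D f →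
        (∀ x ∈ Set.Icc (0 : Fin m → ℝ) 1, ∀ y ∈ Set.Icc (0 : Fin m → ℝ) 1, |f x - f y| ≤ M) →
      ∀ (π : Equiv.Perm (Fin d)) (Ω : Type*) [MeasurableSpace Ω] (μ : Measure Ω)
        [IsProbabilityMeasure μ] (ξ : (Fin m → Fin d) → Ω → ℝ), iIndepFun ξ μ →
        (∀ i, HasSubgaussianMGF (ξ i) (σ ^ 2).toNNReal μ) →
      -- the bound for all block numbers and degrees
      (∀ k ℓ : ℕ, 1 ≤ k → k ≤ d →
        Borda.failureProb μ k ℓ (Borda.signal d f) π ξ (C * Borda.errorBound m d k ℓ α β L σ)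
          ≤ ENNReal.ofReal ((d : ℝ) ^ (-p))) ∧
      -- the rates for the tuned block number and degree
      (ENNReal.ofReal α < Borda.threshold m α β →
        Borda.failureProb μ (Borda.optBlocks m d α β c₁) (Borda.optDegree m α β)
            (Borda.signal d f) π ξ (C * (d : ℝ) ^ (-(2 * (m : ℝ) * α) / ((m : ℝ) + 2 * α)))
          ≤ ENNReal.ofReal ((d : ℝ) ^ (-p))) ∧
      (Borda.threshold m α β ≤ ENNReal.ofReal α →
        Borda.failureProb μ (Borda.optBlocks m d α β c₁) (Borda.optDegree m α β)
            (Borda.signal d f) π ξ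
            (C * (Real.log d / (d : ℝ) ^ (m - 1)) ^ (β * min α 1))
          ≤ ENNReal.ofReal ((d : ℝ) ^ (-p))) := by
  have hm' : (2 : ℝ) ≤ m := by exact_mod_cast hm
  have hκ : 0 ≤ β * min α 1 := mul_nonneg hβ (le_min hα zero_le_one)
  obtain ⟨C, hC, hmain⟩ := Borda.exists_failureProb_le m hm α β L σ hα hβ hL hσ c₀ D M hc₀ p hp
  obtain ⟨C₁, hC₁, herr⟩ := Borda.exists_errorBound_optBlocks_le (β := β) (L := L) (σ := σ)
    hm hα hc₁
  -- the rate in the smoothness-limited regime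
  obtain ⟨C₂, hC₂, hrate⟩ : ∃ C₂ : ℝ, 0 ≤ C₂ ∧ (ENNReal.ofReal α < Borda.threshold m α β →
      ∀ d : ℕ, 1 ≤ d → (Real.log d / (d : ℝ) ^ (m - 1)) ^ (β * min α 1) ≤
        C₂ * (d : ℝ) ^ (-(2 * (m : ℝ) * α) / ((m : ℝ) + 2 * α))) := by
    by_cases h : ENNReal.ofReal α < Borda.threshold m α β
    · obtain ⟨_, h1⟩ := Borda.optDegree_of_lt_threshold hm hα h
      obtain ⟨C₂, hC₂, h2⟩ := Borda.exists_log_rate_le (κ := β * min α 1)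
        (e := 2 * (m : ℝ) * α / ((m : ℝ) + 2 * α)) hm (by positivity) (by
          rw [div_lt_iff₀ (by positivity)]
          linarith)
      refine ⟨C₂, hC₂, fun _ d hd => ?_⟩
      rw [neg_div]
      exact h2 d hd
    · exact ⟨0, le_rfl, fun h' => absurd h' h⟩
  have hlog2 : 0 < Real.log 2 := Real.log_pos one_lt_two
  set S : ℝ := (σ ^ 2) ^ (β * min α 1)
  set R : ℝ := (1 / Real.log 2) ^ (β * min α 1)
  have hS : 0 ≤ S := by positivity
  have hR : 0 ≤ R := by positivity
  refine ⟨C + C * (C₁ + S * C₂) + C * (C₁ * R + S), by positivity, ?_⟩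
  intro d hd f hf hmono hM π Ω _ μ _ ξ hind hsub
  rcases hd.eq_or_lt with rfl | hd2
  · -- for `d = 1` the failure probability is allowed to be `1`
    have hone : ENNReal.ofReal (((1 : ℕ) : ℝ) ^ (-p)) = 1 := by simp
    rw [hone]
    exact ⟨fun _ _ _ _ => prob_le_one, fun _ => prob_le_one, fun _ => prob_le_one⟩
  have hdpos : (0 : ℝ) < d := by exact_mod_cast hd
  have hbound := hmain d hd2 f hf hmono hM π Ω μ ξ hind hsub
  have hopt := hbound _ (Borda.optDegree m α β)
    (Borda.one_le_optBlocks (m := m) (α := α) (β := β) hc₁ hd)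
  have hopt_err := herr d hd
  have a1 : 0 ≤ C * (C₁ + S * C₂) := by positivity
  have a2 : 0 ≤ C * (C₁ * R + S) := by positivity
  have hq : 0 ≤ Real.log d / (d : ℝ) ^ (m - 1) :=
    div_nonneg (Real.log_natCast_nonneg d) (by positivity)
  refine ⟨fun k ℓ hk _ => ?_, fun h => ?_, fun h => ?_⟩
  · refine (Borda.failureProb_anti _ _ _ _ _ _ ?_).trans (hbound k ℓ hk)
    exact mul_le_mul_of_nonneg_right (by linarith) (Borda.errorBound_nonneg hd)
  · refine (Borda.failureProb_anti _ _ _ _ _ _ ?_).trans hopt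
    obtain ⟨hdeg, _⟩ := Borda.optDegree_of_lt_threshold hm hα h
    have hmin : min α ((Borda.optDegree m α β : ℝ) + 1) = α := by
      rw [hdeg]
      exact min_eq_left (Nat.lt_floor_add_one α).le
    rw [hmin] at hopt_err
    have hlog := hrate h d hd
    set x := (d : ℝ) ^ (-(2 * (m : ℝ) * α) / ((m : ℝ) + 2 * α))
    have hx : 0 ≤ x := by positivity
    calc _ ≤ C * (C₁ * x + S * (C₂ * x)) := by
          refine mul_le_mul_of_nonneg_left (hopt_err.trans ?_) hC.le
          gcongr
      _ = C * (C₁ + S * C₂) * x := by ring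
      _ ≤ _ := mul_le_mul_of_nonneg_right (by linarith) hx
  · refine (Borda.failureProb_anti _ _ _ _ _ _ ?_).trans hopt
    have hle := Borda.le_of_threshold_le hm hα hβ h
    set a : ℝ := min α ((Borda.optDegree m α β : ℝ) + 1)
    have ha : 0 ≤ a := le_min hα (by positivity)
    have hlog := Borda.rate_le_log_rate (κ := β * min α 1)
      (e := 2 * (m : ℝ) * a / ((m : ℝ) + 2 * a)) hm hd2 hκ (by
        rw [le_div_iff₀ (by positivity)]
        linarith)
    rw [← neg_div] at hlog
    set y := (Real.log d / (d : ℝ) ^ (m - 1)) ^ (β * min α 1)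
    have hy : 0 ≤ y := by positivity
    calc _ ≤ C * (C₁ * (R * y) + S * y) := by
          refine mul_le_mul_of_nonneg_left (hopt_err.trans ?_) hC.le
          gcongr
      _ = C * (C₁ * R + S) * y := by ring
      _ ≤ _ := mul_le_mul_of_nonneg_right (by linarith) hy
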